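/- Let $k$ be a perfect field of characteristic $p>0$. All groups below are affine algebraic $k$-groups; the Lie algebra of such a group carries its canonical restricted $p$-structure $x\mapsto x^{[p]}$ (the $p$-th power in the algebra of distributions at the unit). Let $W_2$ be the group of $p$-typical Witt vectors of length $2$, $i:\mathbb{G}_a\to W_2$, $x\mapsto(0,x)$, $r:W_2\to\mathbb{G}_a$, $(x_0,x_1)\mapsto x_0$, and $\mathrm{Frob}:\mathbb{G}_a\to\mathbb{G}_a$, $x\mapsto x^p$. Let $c(a,b)$ be the second component of $(a,0)+(b,0)$ in $W_2$, and let $W_2'$ be the group with underlying scheme $\mathbb{A}^2$ and law $$(x_0,x_1)+(y_0,y_1)=\bigl(x_0+y_0,\;x_1+y_1+c(x_0,y_0)^p\bigr),$$ with the morphisms $i':\mathbb{G}_a\to W_2'$, $x\mapsto(0,x)$, $r':W_2'\to\mathbb{G}_a$, $(x_0,x_1)\mapsto x_0$, and $\pi:W_2\to W_2'$, $(x_0,x_1)\mapsto(x_0,x_1^p)$. Then: 1. The sequences $0\to\mathbb{G}_a\xrightarrow{i}W_2\xrightarrow{r}\mathbb{G}_a\to0$ and $0\to\mathbb{G}_a\xrightarrow{i'}W_2'\xrightarrow{r'}\mathbb{G}_a\to0$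 are exact, $\pi\circ i=i'\circ\mathrm{Frob}$, $r'\circ\pi=r$, and $W_2'$ (with $\pi$, $i'$) is the pushout of $i$ and $\mathrm{Frob}$ in the category of commutative affine $k$-groups. 2. The two sequences of Lie algebras $0\to\mathrm{Lie}(\mathbb{G}_a)\to\mathrm{Lie}(W_2)\to\mathrm{Lie}(\mathbb{G}_a)\to0$ and $0\to\mathrm{Lie}(\mathbb{G}_a)\to\mathrm{Lie}(W_2')\to\mathrm{Lie}(\mathbb{G}_a)\to0$ are exact sequences of restricted $p$-Lie algebras, $\mathrm{Lie}(\pi)$ is a morphism of restricted $p$-Lie algebras from the first to the second, inducing $\mathrm{Lie}(\mathrm{Frob})$ on the left and the identity on the right, and $\mathrm{Lie}(\mathrm{Frob})=0$. 3. The groups $\mathbb{G}_a$, $W_2$, $W_2'$ are smooth, connected and unipotent, and their Lie algebras are $p$-nil (every element is killed by an iterate of $x\mapsto x^{[p]}$); thus these Lie algebras are integrable. Here a Lie subalgebra $\mathfrak{v}\subseteq\mathrm{Lie}(G)$ is called integrable (in $G$) if $\mathfrak{v}=\mathrm{Lie}(V)$ for some smooth connected unipotent closed subgroup $V\subseteq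 G$. 4. The morphism $\mathrm{Lie}(r'):\mathrm{Lie}(W_2')\to\mathrm{Lie}(\mathbb{G}_a)$ has a section $s$ that is a morphism of restricted $p$-Lie algebras. 5. For every such section $s$: there is no morphism of algebraic $k$-groups $\sigma:\mathbb{G}_a\to W_2'$ with $\mathrm{Lie}(\sigma)=s$; and the image $s(\mathrm{Lie}(\mathbb{G}_a))$ is a $p$-nil restricted $p$-subalgebra of $\mathrm{Lie}(W_2')$ that is not integrable in $W_2'$. In particular, a morphism between integrable $p$-nil restricted $p$-Lie algebras need not integrate to a morphism of the integrating groups, and a restricted $p$-subalgebra of an integrable one need not be integrable in the integrating group. -/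

import Mathlib

open scoped TensorProduct

universe u

noncomputable section

/-! An affine `k`-group `G` is represented by its coordinate ring `O(G)`, a commutative Hopf algebra
over `k`; a morphism of groups `G → H` is a morphism of bialgebras `O(H) →ₐc[k] O(G)`. -/

namespace AffGrp

section LieAlgebra

variable (k : Type u) [Field k] (A : Type u) [CommRing A] [HopfAlgebra k A]

instance : LieRing (WithConv (A →ₗ[k] k)) := LieRing.ofAssociativeRing

instance : LieAlgebra k (WithConv (A →ₗ[k] k)) := LieAlgebra.ofAssociativeAlgebra

/-- A linear form on `A` is a tangent vector at the unit if it is a derivation with respect to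
the counit. -/
def IsTangent (δ : WithConv (A →ₗ[k] k)) : Prop :=
  ∀ a b : A, δ.ofConv (a * b) =
    Coalgebra.counit (R := k) a * δ.ofConv b + δ.ofConv a * Coalgebra.counit (R := k) b

variable {k A}

/-- `φ ↦ φ ∘ μ`, a morphism for the convolution products. -/
def mulPullback (φ : WithConv (A →ₗ[k] k)) : WithConv (A ⊗[k] A →ₗ[k] k) :=
  .toConv (φ.ofConv ∘ₗ LinearMap.mul' k A)

/-- `φ ⊗ ψ` as a linear form on `A ⊗ A`. -/
def outer (φ ψ : WithConv (A →ₗ[k] k)) : WithConv (A ⊗[k] A →ₗ[k] k) :=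
  .toConv (LinearMap.mul' k k ∘ₗ TensorProduct.map φ.ofConv ψ.ofConv)

lemma mulPullback_mul (φ ψ : WithConv (A →ₗ[k] k)) : mulPullback (φ * ψ) = mulPullback φ * mulPullback ψ := by
  have := LinearMap.convMul_comp_coalgHom_distrib φ ψ (Bialgebra.mulCoalgHom k A)
  exact WithConv.ext this

lemma outer_mul (φ ψ φ' ψ' : WithConv (A →ₗ[k] k)) :
    outer (φ * φ') (ψ * ψ') = outer φ ψ * outer φ' ψ' := by
  have h := TensorProduct.map_convMul_map (f := φ) (g := ψ) (h := φ') (k := ψ')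
  have h2 := LinearMap.algHom_comp_convMul_distrib (Algebra.TensorProduct.lmul' k (S := k))
    (WithConv.toConv (TensorProduct.map φ.ofConv ψ.ofConv))
    (WithConv.toConv (TensorProduct.map φ'.ofConv ψ'.ofConv))
  rw [h] at h2
  exact WithConv.ext h2

lemma isTangent_iff (δ : WithConv (A →ₗ[k] k)) :
    IsTangent k A δ ↔ mulPullback δ = outer 1 δ + outer δ 1 := by
  constructor
  · intro h
    apply WithConv.ext
    apply TensorProduct.ext'
    intro a b
    simpa [mulPullback, outer] using h a b
  · intro h a b
    have := congrArg (fun φ => φ.ofConv (a ⊗ₜ b)) h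
    simpa [mulPullback, outer] using this

lemma mulPullback_one : mulPullback (1 : WithConv (A →ₗ[k] k)) = 1 := by
  apply WithConv.ext
  apply TensorProduct.ext'
  intro a b
  simp [mulPullback, LinearMap.convOne_def, mul_comm]

lemma outer_one : outer (1 : WithConv (A →ₗ[k] k)) 1 = 1 := by
  apply WithConv.ext
  apply TensorProduct.ext'
  intro a b
  simp [outer, LinearMap.convOne_def, mul_comm]

lemma mulPullback_pow (φ : WithConv (A →ₗ[k] k)) (n : ℕ) : mulPullback (φ ^ n) = mulPullback φ ^ n := by
  induction n with
  | zero => simp [mulPullback_one]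
  | succ n ih => rw [pow_succ, mulPullback_mul, ih, pow_succ]

lemma outer_pow (φ ψ : WithConv (A →ₗ[k] k)) (n : ℕ) : outer (φ ^ n) (ψ ^ n) = outer φ ψ ^ n := by
  induction n with
  | zero => simp [outer_one]
  | succ n ih => rw [pow_succ, pow_succ, outer_mul, ih, pow_succ]

lemma outer_comm (φ ψ : WithConv (A →ₗ[k] k)) : Commute (outer 1 φ) (outer ψ 1) := by
  unfold Commute SemiconjBy
  rw [← outer_mul, ← outer_mul]; simp

lemma isTangent_lie {δ δ' : WithConv (A →ₗ[k] k)} (h : IsTangent k A δ)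
    (h' : IsTangent k A δ') : IsTangent k A ⁅δ, δ'⁆ := by
  have h1 : mulPullback (δ * δ') = _ := mulPullback_mul δ δ'
  have h2 : mulPullback (δ' * δ) = _ := mulPullback_mul δ' δ
  rw [isTangent_iff] at *
  have e1 : mulPullback ⁅δ, δ'⁆ = mulPullback (δ * δ') - mulPullback (δ' * δ) := by
    rw [LieRing.of_associative_ring_bracket]
    apply WithConv.ext; apply TensorProduct.ext'; intro a b; simp [mulPullback]
  have e2 : outer 1 ⁅δ, δ'⁆ = outer 1 (δ * δ') - outer 1 (δ' * δ) := by
    rw [LieRing.of_associative_ring_bracket]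
    apply WithConv.ext; apply TensorProduct.ext'; intro a b; simp [outer, mul_sub]
  have e3 : outer ⁅δ, δ'⁆ 1 = outer (δ * δ') 1 - outer (δ' * δ) 1 := by
    rw [LieRing.of_associative_ring_bracket]
    apply WithConv.ext; apply TensorProduct.ext'; intro a b; simp [outer, sub_mul]
  have f1 : outer 1 (δ * δ') = outer 1 δ * outer 1 δ' := by rw [← outer_mul, one_mul]
  have f2 : outer 1 (δ' * δ) = outer 1 δ' * outer 1 δ := by rw [← outer_mul, one_mul]
  have f3 : outer (δ * δ') 1 = outer δ 1 * outer δ' 1 := by rw [← outer_mul, one_mul]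
  have f4 : outer (δ' * δ) 1 = outer δ' 1 * outer δ 1 := by rw [← outer_mul, one_mul]
  rw [e1, e2, e3, h1, h2, h, h', f1, f2, f3, f4, mul_add, add_mul, add_mul, mul_add, add_mul,
    add_mul, (outer_comm δ δ').eq, (outer_comm δ' δ).eq]
  abel

lemma IsTangent.pow_char {p : ℕ} [Fact p.Prime] [CharP k p] {δ : WithConv (A →ₗ[k] k)}
    (h : IsTangent k A δ) : IsTangent k A (δ ^ p) := by
  have : Nontrivial (WithConv (A ⊗[k] A →ₗ[k] k)) := by
    refine ⟨1, 0, fun h => ?_⟩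
    have := congrArg (fun φ => φ.ofConv 1) h
    simp [LinearMap.convOne_def] at this
  have : CharP (WithConv (A ⊗[k] A →ₗ[k] k)) p :=
    charP_of_injective_algebraMap (FaithfulSMul.algebraMap_injective k _) p
  rw [isTangent_iff] at *
  rw [mulPullback_pow, h, add_pow_char_of_commute _ (outer_comm δ δ), ← outer_pow, ← outer_pow, one_pow]

variable (k A)

/-- The Lie algebra of the group with coordinate ring `A`: the tangent vectors at the unit, inside
the associative algebra of linear forms on `A` with the convolution product
`δ * δ' = (δ ⊗ δ') ∘ Δ`. The bracket is the commutator. -/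
def lieAlg : LieSubalgebra k (WithConv (A →ₗ[k] k)) where
  carrier := {δ | IsTangent k A δ}
  add_mem' := by
    intro δ δ' h h' a b
    have h1 := h a b
    have h2 := h' a b
    simp only [WithConv.ofConv_add, LinearMap.add_apply] at *
    rw [h1, h2]; ring
  zero_mem' := by intro a b; simp
  smul_mem' := by
    intro c δ h a b
    have h1 := h a b
    simp only [WithConv.ofConv_smul, LinearMap.smul_apply, smul_eq_mul] at *
    rw [h1]; ring
  lie_mem' := isTangent_lie

variable {k A}

/-- The `p`-structure of the Lie algebra of a group in characteristic `p`: the `p`-th power in the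
convolution algebra. -/
def pMap (p : ℕ) [Fact p.Prime] [CharP k p] (x : lieAlg k A) : lieAlg k A :=
  ⟨x.1 ^ p, IsTangent.pow_char x.2⟩

variable {B : Type u} [CommRing B] [HopfAlgebra k B]

/-- The Lie algebra morphism `Lie(G) → Lie(H)` of a group morphism `G → H`, given by
`f : O(H) → O(G)`: it sends a tangent vector `δ` to `δ ∘ f`. -/
def lieMap (f : B →ₐc[k] A) : lieAlg k A →ₗ⁅k⁆ lieAlg k B where
  toFun x := ⟨.toConv (x.1.ofConv ∘ₗ (f : B →ₗ[k] A)), by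
    intro a b
    have := x.2 (f a) (f b)
    simpa using this⟩
  map_add' x y := by ext; simp
  map_smul' c x := by ext; simp
  map_lie' := by
    intro x y
    apply Subtype.ext
    have h1 := LinearMap.convMul_comp_coalgHom_distrib x.1 y.1 (f : B →ₗc[k] A)
    have h2 := LinearMap.convMul_comp_coalgHom_distrib y.1 x.1 (f : B →ₗc[k] A)
    apply WithConv.ext
    simp only [LieSubalgebra.coe_bracket, LieRing.of_associative_ring_bracket]
    exact (congrArg₂ (· - ·) h1 h2)

/-- A morphism of restricted `p`-Lie algebras: a Lie algebra morphism that commutes with the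
`p`-structures. -/
def IsRestricted (p : ℕ) [Fact p.Prime] [CharP k p] (f : lieAlg k A →ₗ⁅k⁆ lieAlg k B) : Prop :=
  ∀ x, f (pMap p x) = pMap p (f x)

end LieAlgebra

section Laws

/-- A commutative group law on the affine space `𝔸^ι` over `k`: a group structure on the
functor `R ↦ R^ι` on commutative `k`-algebras, natural in `R`. -/
structure GroupLaw (k : Type u) [Field k] (ι : Type) where
  add (R : Type u) [CommRing R] [Algebra k R] : (ι → R) → (ι → R) → (ι → R)
  zero (R : Type u) [CommRing R] [Algebra k R] : ι → R
  neg (R : Type u) [CommRing R] [Algebra k R] : (ι → R) → (ι → R)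
  map_add {R S : Type u} [CommRing R] [Algebra k R] [CommRing S] [Algebra k S] (f : R →ₐ[k] S)
    (x y : ι → R) : f ∘ add R x y = add S (f ∘ x) (f ∘ y)
  map_zero {R S : Type u} [CommRing R] [Algebra k R] [CommRing S] [Algebra k S] (f : R →ₐ[k] S) :
    f ∘ zero R = zero S
  map_neg {R S : Type u} [CommRing R] [Algebra k R] [CommRing S] [Algebra k S] (f : R →ₐ[k] S)
    (x : ι → R) : f ∘ neg R x = neg S (f ∘ x)
  add_comm {R : Type u} [CommRing R] [Algebra k R] (x y : ι → R) : add R x y = add R y x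
  add_assoc {R : Type u} [CommRing R] [Algebra k R] (x y z : ι → R) :
    add R (add R x y) z = add R x (add R y z)
  zero_add {R : Type u} [CommRing R] [Algebra k R] (x : ι → R) : add R (zero R) x = x
  neg_add {R : Type u} [CommRing R] [Algebra k R] (x : ι → R) : add R (neg R x) x = zero R

namespace GroupLaw

variable {k : Type u} [Field k] {ι : Type} (L : GroupLaw k ι)

/-- The coordinate ring of the affine group with group law `L`: polynomials in the coordinates,
with the Hopf algebra structure dual to `L`. -/
def Coord (_ : GroupLaw k ι) : Type u := MvPolynomial ι k

instance : CommRing L.Coord := inferInstanceAs (CommRing (MvPolynomial ι k))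

instance instAlgebraCoord : Algebra k L.Coord := inferInstanceAs (Algebra k (MvPolynomial ι k))

/-- The coordinate functions, i.e. the universal point. -/
def X : ι → L.Coord := fun i => (MvPolynomial.X i : MvPolynomial ι k)

variable {R : Type u} [CommRing R] [Algebra k R]

/-- The morphism `O(G) → R` given by an `R`-point of `G`. -/
def point (x : ι → R) : L.Coord →ₐ[k] R := (MvPolynomial.aeval x : MvPolynomial ι k →ₐ[k] R)

@[simp] lemma point_X (x : ι → R) (i : ι) : L.point x (L.X i) = x i :=
  MvPolynomial.aeval_X x i

lemma point_comp_X (x : ι → R) : L.point x ∘ L.X = x := funext (L.point_X x)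

variable {L} in
lemma algHom_ext {f g : L.Coord →ₐ[k] R} (h : f ∘ L.X = g ∘ L.X) : f = g :=
  MvPolynomial.algHom_ext (σ := ι) (R := k) (fun i => congrFun h i)

def comulHom : L.Coord →ₐ[k] L.Coord ⊗[k] L.Coord :=
  L.point (L.add _ ((Algebra.TensorProduct.includeLeft : L.Coord →ₐ[k] L.Coord ⊗[k] L.Coord) ∘ L.X)
    ((Algebra.TensorProduct.includeRight : L.Coord →ₐ[k] L.Coord ⊗[k] L.Coord) ∘ L.X))

lemma comp_comulHom (f : L.Coord ⊗[k] L.Coord →ₐ[k] R) :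
    (f.comp L.comulHom) ∘ L.X =
      L.add R ((f.comp Algebra.TensorProduct.includeLeft) ∘ L.X)
        ((f.comp Algebra.TensorProduct.includeRight) ∘ L.X) := by
  rw [AlgHom.coe_comp, Function.comp_assoc, comulHom, point_comp_X, L.map_add]
  rfl

def counitHom : L.Coord →ₐ[k] k := L.point (L.zero k)

def antipodeHom : L.Coord →ₐ[k] L.Coord := L.point (L.neg _ L.X)

lemma add_zero (x : ι → R) : L.add R x (L.zero R) = x := by rw [L.add_comm, L.zero_add]

lemma comp_counitHom (f : k →ₐ[k] R) : (f.comp L.counitHom) ∘ L.X = L.zero R := by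
  rw [AlgHom.coe_comp, Function.comp_assoc, counitHom, point_comp_X, L.map_zero]

instance instBialgebraCoord : Bialgebra k L.Coord :=
  Bialgebra.ofAlgHom L.comulHom L.counitHom
    (by
      apply algHom_ext
      rw [← AlgHom.comp_assoc, L.comp_comulHom, L.comp_comulHom]
      have e1 := L.comp_comulHom
        (((Algebra.TensorProduct.assoc k k k L.Coord L.Coord L.Coord).toAlgHom.comp
          (Algebra.TensorProduct.includeLeft :
            L.Coord ⊗[k] L.Coord →ₐ[k] (L.Coord ⊗[k] L.Coord) ⊗[k] L.Coord)))
      have e2 := L.comp_comulHom (Algebra.TensorProduct.includeRight :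
            L.Coord ⊗[k] L.Coord →ₐ[k] L.Coord ⊗[k] (L.Coord ⊗[k] L.Coord))
      rw [AlgHom.comp_assoc, Algebra.TensorProduct.map_comp_includeLeft,
        Algebra.TensorProduct.map_comp_includeRight, ← AlgHom.comp_assoc, e1, e2, L.add_assoc]
      congr 1
      · funext i; simp [Algebra.TensorProduct.one_def]
      congr 1
      funext i; simp [Algebra.TensorProduct.one_def])
    (by
      apply algHom_ext
      rw [L.comp_comulHom, Algebra.TensorProduct.map_comp_includeLeft, L.comp_counitHom,
        L.zero_add]
      funext i; simp)
    (by
      apply algHom_ext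
      rw [L.comp_comulHom, Algebra.TensorProduct.map_comp_includeRight, L.comp_counitHom,
        L.add_zero]
      funext i; simp)

lemma lift_antipodeHom_left :
    (Algebra.TensorProduct.lift L.antipodeHom (.id k L.Coord) fun _ _ ↦ Commute.all _ _).comp
      L.comulHom = (Algebra.ofId k L.Coord).comp L.counitHom := by
  apply algHom_ext
  rw [L.comp_comulHom, L.comp_counitHom, ← L.neg_add L.X]
  refine congrArg₂ (L.add _) ?_ ?_
  · refine Eq.trans ?_ (L.point_comp_X _)
    funext i; simp [antipodeHom]
  · funext i; simp

lemma lift_antipodeHom_right :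
    (Algebra.TensorProduct.lift (.id k L.Coord) L.antipodeHom fun _ _ ↦ Commute.all _ _).comp
      L.comulHom = (Algebra.ofId k L.Coord).comp L.counitHom := by
  apply algHom_ext
  rw [L.comp_comulHom, L.comp_counitHom, ← L.neg_add L.X, L.add_comm]
  refine congrArg₂ (L.add _) ?_ ?_
  · refine Eq.trans ?_ (L.point_comp_X _)
    funext i; simp [antipodeHom]
  · funext i; simp

instance instHopfAlgebraCoord : HopfAlgebra k L.Coord :=
  HopfAlgebra.ofAlgHom L.antipodeHom L.lift_antipodeHom_left L.lift_antipodeHom_right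

instance : Coalgebra.IsCocomm k L.Coord where
  comm_comp_comul := by
    have : (Algebra.TensorProduct.comm k L.Coord L.Coord).toAlgHom.comp L.comulHom = L.comulHom := by
      apply algHom_ext
      rw [L.comp_comulHom]
      rw [L.add_comm]
      refine Eq.trans ?_ (L.point_comp_X _).symm
      congr 1
    exact congrArg AlgHom.toLinearMap this

/-- A morphism of affine groups, as a natural family of additive maps on points. -/
structure Hom {ι κ : Type} (L : GroupLaw k ι) (M : GroupLaw k κ) where
  app (R : Type u) [CommRing R] [Algebra k R] : (ι → R) → (κ → R)
  naturality {R S : Type u} [CommRing R] [Algebra k R] [CommRing S] [Algebra k S] (f : R →ₐ[k] S)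
    (x : ι → R) : f ∘ app R x = app S (f ∘ x)
  map_add {R : Type u} [CommRing R] [Algebra k R] (x y : ι → R) :
    app R (L.add R x y) = M.add R (app R x) (app R y)

variable {κ : Type} {L} {M : GroupLaw k κ}

/-- The morphism of coordinate rings `O(M) → O(L)` of a morphism of groups `L → M`. -/
def Hom.comorphism (φ : Hom L M) : M.Coord →ₐc[k] L.Coord :=
  BialgHom.ofAlgHom (M.point (φ.app _ L.X))
    (by
      apply algHom_ext
      rw [AlgHom.coe_comp, Function.comp_assoc, point_comp_X, φ.naturality]
      refine Eq.trans ?_ (M.point_comp_X _).symm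
      have h0 : (Bialgebra.counitAlgHom k L.Coord) ∘ L.X = L.zero k := L.point_comp_X _
      rw [h0]
      have h := φ.map_add (L.zero k) (L.zero k)
      rw [L.zero_add] at h
      have h2 := congrArg (M.add k (M.neg k (φ.app k (L.zero k)))) h
      rw [M.neg_add, ← M.add_assoc, M.neg_add, M.zero_add] at h2
      exact h2.symm)
    (by
      apply algHom_ext
      refine (M.comp_comulHom _).trans ?_
      rw [Algebra.TensorProduct.map_comp_includeLeft, Algebra.TensorProduct.map_comp_includeRight]
      rw [AlgHom.coe_comp, AlgHom.coe_comp, AlgHom.coe_comp, Function.comp_assoc,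
        Function.comp_assoc, Function.comp_assoc, point_comp_X, φ.naturality, φ.naturality,
        φ.naturality, ← φ.map_add]
      congr 1
      exact (L.point_comp_X _).symm)

end GroupLaw

/-- The additive group `𝔾ₐ`. -/
def Ga (k : Type u) [Field k] : GroupLaw k Unit where
  add _ _ _ x y := x + y
  zero _ _ _ := 0
  neg _ _ _ x := -x
  map_add f x y := by funext i; simp
  map_zero f := by funext i; simp
  map_neg f x := by funext i; simp
  add_comm x y := _root_.add_comm x y
  add_assoc x y z := _root_.add_assoc x y z
  zero_add x := _root_.zero_add x
  neg_add x := neg_add_cancel x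

section Witt

lemma witt_mk_eta (p : ℕ) {R : Type u} (x : Fin 2 → R) :
    TruncatedWittVector.mk p x = TruncatedWittVector.mk p ![x 0, x 1] := by
  congr 1; funext i; fin_cases i <;> rfl

lemma witt_mk_injective (p : ℕ) {R : Type u} {x y : Fin 2 → R}
    (h : TruncatedWittVector.mk p x = TruncatedWittVector.mk p y) : x = y := h

variable (p : ℕ) [Fact p.Prime]

lemma witt_map_add {R S : Type u} [CommRing R] [CommRing S] (f : R →+* S) (n : ℕ)
    (x y : Fin n → R) (i : Fin n) :
    f ((TruncatedWittVector.mk p x + TruncatedWittVector.mk p y).coeff i) =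
      (TruncatedWittVector.mk p (f ∘ x) + TruncatedWittVector.mk p (f ∘ y)).coeff i := by
  have key : ∀ z : Fin n → R, WittVector.map f (TruncatedWittVector.out (.mk p z)) =
      TruncatedWittVector.out (.mk p (f ∘ z)) := by
    intro z
    ext j
    rw [WittVector.map_coeff]
    unfold TruncatedWittVector.out
    simp only
    split_ifs <;> simp
  change f ((WittVector.truncateFun n (_ + _)).coeff i) = (WittVector.truncateFun n (_ + _)).coeff i
  rw [WittVector.coeff_truncateFun, WittVector.coeff_truncateFun, ← WittVector.map_coeff,
    _root_.map_add, key, key]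

lemma witt_map_neg {R S : Type u} [CommRing R] [CommRing S] (f : R →+* S) (n : ℕ)
    (x : Fin n → R) (i : Fin n) :
    f ((-TruncatedWittVector.mk p x).coeff i) = (-TruncatedWittVector.mk p (f ∘ x)).coeff i := by
  have key : ∀ z : Fin n → R, WittVector.map f (TruncatedWittVector.out (.mk p z)) =
      TruncatedWittVector.out (.mk p (f ∘ z)) := by
    intro z
    ext j
    rw [WittVector.map_coeff]
    unfold TruncatedWittVector.out
    simp only
    split_ifs <;> simp
  change f ((WittVector.truncateFun n (-_)).coeff i) = (WittVector.truncateFun n (-_)).coeff i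
  rw [WittVector.coeff_truncateFun, WittVector.coeff_truncateFun, ← WittVector.map_coeff,
    _root_.map_neg, key]

/-- The group `W₂` of `p`-typical Witt vectors of length two: `R ↦ W₂(R)` under addition. -/
def W2 (k : Type u) [Field k] : GroupLaw k (Fin 2) where
  add _ _ _ x y := (TruncatedWittVector.mk p x + TruncatedWittVector.mk p y).coeff
  zero _ _ _ := (0 : TruncatedWittVector p 2 _).coeff
  neg _ _ _ x := (-TruncatedWittVector.mk p x).coeff
  map_add f x y := funext fun i => witt_map_add p f.toRingHom 2 x y i
  map_zero f := by funext i; simp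
  map_neg f x := funext fun i => witt_map_neg p f.toRingHom 2 x i
  add_comm x y := by rw [_root_.add_comm]
  add_assoc x y z := by simp [_root_.add_assoc]
  zero_add x := by
    have h := congrArg (fun w i => TruncatedWittVector.coeff i w)
      (_root_.zero_add (TruncatedWittVector.mk p x))
    exact h
  neg_add x := by simp

/-- The cocycle of the extension `W₂` of `𝔾ₐ` by `𝔾ₐ`: the second component of
`(a, 0) + (b, 0)` in `W₂(R)`. -/
def wittCocycle {R : Type u} [CommRing R] (a b : R) : R :=
  (TruncatedWittVector.mk p ![a, 0] + TruncatedWittVector.mk p ![b, 0]).coeff 1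

lemma witt_add_zero {R : Type u} [CommRing R] (x y : Fin 2 → R) :
    (TruncatedWittVector.mk p x + TruncatedWittVector.mk p y).coeff 0 = x 0 + y 0 := by
  change (WittVector.truncateFun 2 (_ + _)).coeff 0 = _
  rw [WittVector.coeff_truncateFun]
  simp [WittVector.add_coeff_zero, TruncatedWittVector.out]

/-- Witt vectors `(0, a)` add componentwise. -/
lemma witt_add_V {R : Type u} [CommRing R] (a b : R) :
    TruncatedWittVector.mk p ![0, a] + TruncatedWittVector.mk p ![0, b] =
      TruncatedWittVector.mk p ![0, a + b] := by
  have key : ∀ c : R, TruncatedWittVector.mk p ![0, c] =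
      WittVector.truncate 2 (WittVector.verschiebung (WittVector.teichmuller p c)) := by
    intro c
    ext i
    rw [WittVector.coeff_truncate]
    fin_cases i
    · simp
    · simp [WittVector.verschiebung_coeff_succ]
  rw [key, key, ← _root_.map_add (WittVector.truncate 2)]
  ext i
  rw [WittVector.coeff_truncate]
  fin_cases i
  · simp [WittVector.add_coeff_zero]
  · rw [← _root_.map_add WittVector.verschiebung]
    exact (WittVector.verschiebung_coeff_succ _ 0).trans (by simp [WittVector.add_coeff_zero])

lemma witt_decomp {R : Type u} [CommRing R] (a b : R) :
    TruncatedWittVector.mk p ![a, 0] + TruncatedWittVector.mk p ![0, b] =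
      TruncatedWittVector.mk p ![a, b] := by
  ext i
  change (WittVector.truncateFun 2 (_ + _)).coeff i = _
  rw [WittVector.coeff_truncateFun, WittVector.coeff_add_of_disjoint]
  · fin_cases i <;> simp [TruncatedWittVector.out]
  · intro n
    rcases n with _ | _ | n <;> simp [TruncatedWittVector.out]

lemma witt_add {R : Type u} [CommRing R] (x y : Fin 2 → R) :
    TruncatedWittVector.mk p x + TruncatedWittVector.mk p y =
      TruncatedWittVector.mk p ![x 0 + y 0, x 1 + y 1 + wittCocycle p (x 0) (y 0)] := by
  have hs : TruncatedWittVector.mk p ![x 0, 0] + TruncatedWittVector.mk p ![y 0, 0] =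
      TruncatedWittVector.mk p ![x 0 + y 0, wittCocycle p (x 0) (y 0)] := by
    ext i
    fin_cases i
    · simp [witt_add_zero]
    · simp [wittCocycle]
  rw [witt_mk_eta p x, witt_mk_eta p y, ← witt_decomp, ← witt_decomp p (y 0), add_add_add_comm, hs,
    witt_add_V, ← witt_decomp, _root_.add_assoc, witt_add_V, witt_decomp]
  simp [_root_.add_comm]

lemma wittCocycle_comm {R : Type u} [CommRing R] (a b : R) :
    wittCocycle p a b = wittCocycle p b a := by
  unfold wittCocycle; rw [_root_.add_comm]

lemma wittCocycle_assoc {R : Type u} [CommRing R] (a b c : R) :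
    wittCocycle p a b + wittCocycle p (a + b) c = wittCocycle p b c + wittCocycle p a (b + c) := by
  have h := _root_.add_assoc (TruncatedWittVector.mk p ![a, 0]) (TruncatedWittVector.mk p ![b, 0])
    (TruncatedWittVector.mk p ![c, 0])
  rw [witt_add, witt_add, witt_add, witt_add] at h
  simpa using congrFun (witt_mk_injective p h) 1

lemma wittCocycle_zero {R : Type u} [CommRing R] (b : R) : wittCocycle p 0 b = 0 := by
  have h0 : TruncatedWittVector.mk p ![(0 : R), 0] = 0 := by
    ext i; rw [TruncatedWittVector.coeff_zero]; fin_cases i <;> simp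
  unfold wittCocycle
  rw [h0, _root_.zero_add]; simp

lemma map_wittCocycle {R S : Type u} [CommRing R] [CommRing S] (f : R →+* S) (a b : R) :
    f (wittCocycle p a b) = wittCocycle p (f a) (f b) := by
  unfold wittCocycle
  rw [witt_map_add]
  congr 3 <;> (funext i; fin_cases i <;> simp)

lemma frob_add (k : Type u) [Field k] [CharP k p] {R : Type u} [CommRing R] [Algebra k R]
    (a b : R) : (a + b) ^ p = a ^ p + b ^ p := by
  rcases subsingleton_or_nontrivial R with h | h
  · exact Subsingleton.elim _ _
  · have : CharP R p := charP_of_injective_algebraMap (algebraMap k R).injective p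
    exact add_pow_char a b p

/-- The pushout `W₂'` of `W₂` along the Frobenius of `𝔾ₐ`: the extension of `𝔾ₐ` by `𝔾ₐ` whose
cocycle is the Frobenius of the cocycle of `W₂`. -/
def W2Frob (k : Type u) [Field k] [CharP k p] : GroupLaw k (Fin 2) where
  add _ _ _ x y := ![x 0 + y 0, x 1 + y 1 + wittCocycle p (x 0) (y 0) ^ p]
  zero _ _ _ := 0
  neg _ _ _ x := ![-x 0, -x 1 - wittCocycle p (-x 0) (x 0) ^ p]
  map_add f x y := by
    funext i
    fin_cases i
    · simp
    · simpa using congrArg (· ^ p) (map_wittCocycle p f.toRingHom (x 0) (y 0))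
  map_zero f := by funext i; simp
  map_neg f x := by
    funext i
    fin_cases i
    · simp
    · simpa using congrArg (· ^ p) (map_wittCocycle p f.toRingHom (-x 0) (x 0))
  add_comm x y := by
    rw [wittCocycle_comm, _root_.add_comm (x 0), _root_.add_comm (x 1)]
  add_assoc x y z := by
    funext i
    fin_cases i
    · simp [_root_.add_assoc]
    · have h := congrArg (· ^ p) (wittCocycle_assoc p (x 0) (y 0) (z 0))
      simp only [frob_add p k] at h
      simp
      linear_combination h
  zero_add x := by
    funext i
    fin_cases i
    · simp
    · simp [wittCocycle_zero, (Fact.out : p.Prime).ne_zero]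
  neg_add x := by
    funext i
    fin_cases i
    · simp
    · simp
      ring

variable (k : Type u) [Field k]

/-- `i : 𝔾ₐ → W₂`, `x ↦ (0, x)`. -/
def inclW2 : GroupLaw.Hom (Ga k) (W2 p k) where
  app _ _ _ x := ![0, x ()]
  naturality f x := by funext i; fin_cases i <;> simp
  map_add x y := by
    have h := (witt_add_V p (x ()) (y ())).symm
    exact funext fun i => congrArg (TruncatedWittVector.coeff i) h

/-- `r : W₂ → 𝔾ₐ`, `(x₀, x₁) ↦ x₀`. -/
def projW2 : GroupLaw.Hom (W2 p k) (Ga k) where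
  app _ _ _ x := fun _ => x 0
  naturality _ _ := rfl
  map_add x y := funext fun _ => witt_add_zero p x y

variable [CharP k p]

/-- `Frob : 𝔾ₐ → 𝔾ₐ`, `x ↦ x ^ p`. -/
def frobGa : GroupLaw.Hom (Ga k) (Ga k) where
  app _ _ _ x := fun i => x i ^ p
  naturality f x := by funext i; simp
  map_add x y := funext fun _ => frob_add p k _ _

/-- `W₂ → W₂'`, `(x₀, x₁) ↦ (x₀, x₁ ^ p)`. -/
def toW2Frob : GroupLaw.Hom (W2 p k) (W2Frob p k) where
  app _ _ _ x := ![x 0, x 1 ^ p]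
  naturality f x := by funext i; fin_cases i <;> simp
  map_add x y := by
    have h : (W2 p k).add _ x y = _ := witt_mk_injective p (witt_add p x y)
    rw [h]
    funext i
    fin_cases i
    · simp [W2Frob]
    · simp [W2Frob, frob_add p k]

/-- `𝔾ₐ → W₂'`, `x ↦ (0, x)`. -/
def inclW2Frob : GroupLaw.Hom (Ga k) (W2Frob p k) where
  app _ _ _ x := ![0, x ()]
  naturality f x := by funext i; fin_cases i <;> simp
  map_add x y := by
    funext i
    fin_cases i
    · simp [W2Frob]
    · simp [W2Frob, Ga, wittCocycle_zero, (Fact.out : p.Prime).ne_zero]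

/-- `W₂' → 𝔾ₐ`, `(x₀, x₁) ↦ x₀`. -/
def projW2Frob : GroupLaw.Hom (W2Frob p k) (Ga k) where
  app _ _ _ x := fun _ => x 0
  naturality _ _ := rfl
  map_add x y := by funext i; simp [W2Frob, Ga]

end Witt
end Laws

section Notions

variable {k : Type u} [Field k]
variable {A B C : Type u} [CommRing A] [HopfAlgebra k A] [CommRing B] [HopfAlgebra k B]
  [CommRing C] [HopfAlgebra k C]

/-- `1 → N → G → Q → 1` is an exact sequence of affine `k`-groups, for `f : O(G) → O(N)` and
`g : O(Q) → O(G)`: `N → G` is a closed immersion, `G → Q` is faithfully flat, and `N` is the kernel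
of `G → Q`, i.e. the fibre over the unit of `Q`. -/
structure IsShortExact (f : B →ₐc[k] A) (g : C →ₐc[k] B) : Prop where
  closedImmersion : Function.Surjective f
  faithfullyFlat : ((g : C →ₐ[k] B) : C →+* B).FaithfullyFlat
  kernel : RingHom.ker (f : B →ₐ[k] A) =
    (RingHom.ker (Bialgebra.counitAlgHom k C)).map ((g : C →ₐ[k] B) : C →+* B)

/-- The square of affine `k`-groups
```
  N ──→ G
  │     │
  ↓     ↓
  M ──→ E
```
given by `f : O(G) → O(N)`, `φ : O(M) → O(N)`, `π : O(E) → O(G)`, `j : O(E) → O(M)`, is a pushout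
in the category of commutative affine `k`-groups. -/
structure IsPushout {N G M E : Type u} [CommRing N] [HopfAlgebra k N] [CommRing G]
    [HopfAlgebra k G] [CommRing M] [HopfAlgebra k M] [CommRing E] [HopfAlgebra k E]
    (f : G →ₐc[k] N) (φ : M →ₐc[k] N) (π : E →ₐc[k] G) (j : E →ₐc[k] M) : Prop where
  cocomm : Coalgebra.IsCocomm k E
  comm : f.comp π = φ.comp j
  universal (H : Type u) [CommRing H] [HopfAlgebra k H] [Coalgebra.IsCocomm k H]
    (a : H →ₐc[k] G) (b : H →ₐc[k] M) (hab : f.comp a = φ.comp b) :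
    ∃! c : H →ₐc[k] E, π.comp c = a ∧ j.comp c = b

/-- `0 → 𝔫 → 𝔤 → 𝔮 → 0` is an exact sequence of restricted `p`-Lie algebras. -/
structure IsLieShortExact (p : ℕ) [Fact p.Prime] [CharP k p]
    (f : lieAlg k A →ₗ⁅k⁆ lieAlg k B) (g : lieAlg k B →ₗ⁅k⁆ lieAlg k C) : Prop where
  restricted_left : IsRestricted p f
  restricted_right : IsRestricted p g
  injective : Function.Injective f
  exact : Function.Exact f g
  surjective : Function.Surjective g

/-- A Lie subalgebra is `p`-nil if each of its elements is killed by an iterate of the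
`p`-structure. -/
def IsPNil (p : ℕ) [Fact p.Prime] [CharP k p] (v : LieSubalgebra k (lieAlg k A)) : Prop :=
  ∀ x ∈ v, ∃ n : ℕ, (pMap p)^[n] x = 0

/-- A Lie subalgebra is a restricted `p`-subalgebra if it is stable under the `p`-structure. -/
def IsPSubalgebra (p : ℕ) [Fact p.Prime] [CharP k p] (v : LieSubalgebra k (lieAlg k A)) : Prop :=
  ∀ x ∈ v, pMap p x ∈ v

variable (k A) in
/-- The affine algebraic group with coordinate ring `A` is unipotent: it is isomorphic to a closed
subgroup of a group of upper triangular unipotent matrices, i.e. it has an upper triangular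
unipotent matrix representation `M` whose entries generate the coordinate ring. -/
def IsUnipotent : Prop :=
  ∃ (n : ℕ) (M : Matrix (Fin n) (Fin n) A),
    (∀ i, M i i = 1) ∧ (∀ i j, j < i → M i j = 0) ∧
    (∀ i j, Coalgebra.comul (R := k) (M i j) = ∑ l, M i l ⊗ₜ[k] M l j) ∧
    Algebra.adjoin k (Set.range fun ij : Fin n × Fin n => M ij.1 ij.2) = ⊤

variable (k A) in
/-- The affine algebraic group with coordinate ring `A` is smooth, connected and unipotent. -/
structure IsSmoothConnectedUnipotent : Prop where
  smooth : Algebra.Smooth k A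
  connected : ConnectedSpace (PrimeSpectrum A)
  unipotent : IsUnipotent k A

/-- A Lie subalgebra `v` of `Lie(G)` is integrable (in `G`) if `v = Lie(V)` for a smooth connected
unipotent closed subgroup `V` of `G`. -/
def IsIntegrable (v : LieSubalgebra k (lieAlg k A)) : Prop :=
  ∃ (V : Type u) (_ : CommRing V) (_ : HopfAlgebra k V) (q : A →ₐc[k] V),
    Function.Surjective q ∧ IsSmoothConnectedUnipotent k V ∧ (lieMap q).range = v

/-- A morphism `Lie(G) → Lie(H)` is integrable if it is `Lie(σ)` for a morphism of groups
`σ : G → H`; here `A = O(G)`, `B = O(H)`. -/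
def IsIntegrableHom (s : lieAlg k A →ₗ⁅k⁆ lieAlg k B) : Prop :=
  ∃ σ : B →ₐc[k] A, lieMap σ = s

end Notions

end AffGrp

end

namespace AffGrp

/-! ### Tangent vectors and their convolution powers in characteristic `p` -/

section Tangent

variable {k : Type u} [Field k] {A B : Type u} [CommRing A] [HopfAlgebra k A] [CommRing B]
  [HopfAlgebra k B]

/-! The Lie algebra cannot see the cocycle of `W₂'`, whereas multiplication by `p` can. The
counterexample lives in this gap.

Tangent vectors kill `p`-th powers. The comultiplication of `W₂'` is additive up to the `p`-th power
of the Witt cocycle, so the `p`-map of `Lie(W₂')` vanishes (`IsTangent.pow_char_apply_eq_zero`,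
`pMap_W2Frob`). The bracket vanishes too, by commutativity, so any linear section of `Lie(r')` is a
morphism of restricted Lie algebras. On the other hand `p = VF` on Witt vectors gives `p · (x₀, x₁)
= (0, x₀ ^ p ^ 2)` on `W₂'` (`W2Frob_nsmul_char`).

A morphism `σ : 𝔾ₐ → W₂'` commutes with multiplication by `p`, which is zero on `𝔾ₐ`. Hence the `p ^
2`-th power of the first coordinate of `σ` is zero, so that coordinate is zero and `Lie(σ)` is no
section (`bialgHom_W2Frob_Ga_X`). Suppose next that the image of a section is `Lie(V)` with `V`
smooth. The restriction `t` of `x₀` to `V` has nonzero differential at the unit. By smoothness `t`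
is transcendental (`transcendental_of_tangent`), and so is `t ^ p ^ 2`. Multiplication by `p`
therefore maps `V` dominantly to the kernel of `r'`, so `V` contains this kernel and `Lie(V)`
contains `Lie(𝔾ₐ)`, which meets the image of a section only in zero (`range_lieMap_inclW2Frob_le`).

The pushout property rests on the injectivity of `O(W₂') → O(W₂)`: the candidate `(x₀, x₁) ↦ a(x₀,
0) + b(x₁)` need only be compared with `a` after pulling back to `W₂`. Unipotence comes from a
finite-dimensional, translation-stable space of functions that generates the coordinate ring and on
which translations are triangular (`isUnipotent_of_cocycle`). -/

lemma IsTangent.apply_one {δ : WithConv (A →ₗ[k] k)} (h : IsTangent k A δ) : δ.ofConv 1 = 0 := by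
  have := h 1 1
  simpa using this

lemma IsTangent.apply_pow {δ : WithConv (A →ₗ[k] k)} (h : IsTangent k A δ) (a : A) (n : ℕ) :
    δ.ofConv (a ^ n) = n * (Coalgebra.counit (R := k) a) ^ (n - 1) * δ.ofConv a := by
  induction n with
  | zero => simp [h.apply_one]
  | succ n ih =>
    rw [pow_succ, h, ih, Bialgebra.counit_pow]
    rcases n with _ | n
    · simp
    · simp only [Nat.add_sub_cancel, Nat.cast_add, Nat.cast_one, pow_succ]
      ring

/-- The Leibniz rule produces a factor `p`. This is why `Lie(Frob) = 0`, and why a cocycle that is a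
`p`-th power is invisible on tangent vectors. -/
lemma IsTangent.apply_pow_char (p : ℕ) [Fact p.Prime] [CharP k p] {δ : WithConv (A →ₗ[k] k)}
    (h : IsTangent k A δ) (a : A) : δ.ofConv (a ^ p) = 0 := by
  simp [h.apply_pow]

/-- A tangent vector kills `p`-th powers, so `φ ⊗ δ` does. -/
lemma IsTangent.outer_pow_char (p : ℕ) [Fact p.Prime] [CharP k p] {δ : WithConv (A →ₗ[k] k)}
    (h : IsTangent k A δ) (φ : WithConv (A →ₗ[k] k)) (z : A ⊗[k] A) :
    (outer φ δ).ofConv (z ^ p) = 0 := by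
  induction z with
  | zero => simp [(Fact.out : p.Prime).ne_zero]
  | tmul a b => simp [outer, Algebra.TensorProduct.tmul_pow, h.apply_pow_char p]
  | add x y hx hy => rw [frob_add p k, map_add, hx, hy, add_zero]

lemma IsTangent.pow_apply_one {δ : WithConv (A →ₗ[k] k)} (h : IsTangent k A δ) {n : ℕ}
    (hn : n ≠ 0) : (δ ^ n).ofConv 1 = 0 := by
  obtain ⟨n, rfl⟩ := Nat.exists_eq_succ_of_ne_zero hn
  rw [pow_succ, LinearMap.convMul_apply]
  simp [Bialgebra.comul_one, Algebra.TensorProduct.one_def, h.apply_one]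

lemma convMul_apply_eq_outer (φ ψ : WithConv (A →ₗ[k] k)) (a : A) :
    (φ * ψ).ofConv a = (outer φ ψ).ofConv (Coalgebra.comul (R := k) a) := rfl

/-- A coordinate on which the group law is additive up to a `p`-th power is killed by `p`-th
powers of tangent vectors. -/
lemma IsTangent.pow_char_apply_eq_zero (p : ℕ) [Fact p.Prime] [CharP k p]
    {δ : WithConv (A →ₗ[k] k)} (h : IsTangent k A δ) {a : A} {z : A ⊗[k] A}
    (ha : Coalgebra.comul (R := k) a = a ⊗ₜ 1 + 1 ⊗ₜ a + z ^ p) : (δ ^ p).ofConv a = 0 := by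
  have hp := (Fact.out : p.Prime).two_le
  obtain ⟨n, hn⟩ : ∃ n, p = n + 1 := ⟨p - 1, by omega⟩
  -- Splitting off one factor `δ` on the right kills the `p`-th power term. Since `n = p - 1` is
  -- nonzero, `δ ^ n` kills `1`, so both remaining terms vanish.
  have e : δ ^ p = δ ^ n * δ := by rw [hn, pow_succ]
  rw [e, convMul_apply_eq_outer, ha, map_add, h.outer_pow_char p, map_add]
  simp [outer, h.apply_one, h.pow_apply_one (show n ≠ 0 by omega)]

/-- Composition with a coalgebra morphism is multiplicative for convolution, so it preserves all
powers, the `p`-th among them. -/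
lemma isRestricted_lieMap (p : ℕ) [Fact p.Prime] [CharP k p] (f : B →ₐc[k] A) :
    IsRestricted p (lieMap f) := by
  intro x
  apply Subtype.ext
  change WithConv.toConv ((x.1 ^ p).ofConv ∘ₗ (f : B →ₗ[k] A)) =
    WithConv.toConv (x.1.ofConv ∘ₗ (f : B →ₗ[k] A)) ^ p
  generalize p = n
  induction n with
  | zero =>
    apply WithConv.ext
    ext b
    simp [LinearMap.convOne_def]
  | succ n ih =>
    rw [pow_succ, pow_succ, ← ih]
    exact WithConv.ext (LinearMap.convMul_comp_coalgHom_distrib (x.1 ^ n) x.1 (f : B →ₗc[k] A))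

lemma lieMap_apply (f : B →ₐc[k] A) (x : lieAlg k A) (b : B) :
    (lieMap f x).1.ofConv b = x.1.ofConv (f b) := rfl

lemma lieMap_comp {C : Type u} [CommRing C] [HopfAlgebra k C] (f : B →ₐc[k] A) (g : C →ₐc[k] B) :
    (lieMap g).comp (lieMap f) = lieMap (f.comp g) := rfl

/-- Cocommutativity makes the convolution algebra commutative. -/
lemma lie_eq_zero_of_isCocomm [Coalgebra.IsCocomm k A] (x y : lieAlg k A) : ⁅x, y⁆ = 0 := by
  apply Subtype.ext
  change x.1 * y.1 - y.1 * x.1 = 0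
  rw [sub_eq_zero]
  exact mul_comm (G := WithConv (A →ₗ[k] k)) x.1 y.1

end Tangent

/-! ### Tangent vectors in coordinates -/

namespace GroupLaw

variable {k : Type u} [Field k] {ι κ : Type} {L : GroupLaw k ι} {M : GroupLaw k κ}

@[simp] lemma Hom.comorphism_X (φ : Hom L M) (j : κ) : φ.comorphism (M.X j) = φ.app _ L.X j :=
  M.point_X _ _

lemma bialgHom_ext {A : Type u} [CommRing A] [HopfAlgebra k A] {f g : L.Coord →ₐc[k] A}
    (h : ∀ i, f (L.X i) = g (L.X i)) : f = g := by
  have : (f : L.Coord →ₐ[k] A) = g := algHom_ext (funext h)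
  exact BialgHom.coe_toAlgHom_injective this

lemma comul_X (i : ι) : Coalgebra.comul (R := k) (L.X i) =
    L.add _ (fun i => L.X i ⊗ₜ[k] (1 : L.Coord)) (fun i => (1 : L.Coord) ⊗ₜ[k] L.X i) i :=
  L.point_X _ _

lemma counit_X (i : ι) : Coalgebra.counit (R := k) (L.X i) = L.zero k i := L.point_X _ _

lemma coord_induction {P : L.Coord → Prop} (a : L.Coord) (hC : ∀ c : k, P (algebraMap k _ c))
    (hadd : ∀ a b, P a → P b → P (a + b)) (hX : ∀ a i, P a → P (a * L.X i)) : P a :=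
  MvPolynomial.induction_on (motive := P) a hC hadd hX

/-- By the Leibniz rule, a tangent vector is determined by its values on the generators of the
coordinate ring. -/
lemma lieAlg_ext {x y : lieAlg k L.Coord} (h : ∀ i, x.1.ofConv (L.X i) = y.1.ofConv (L.X i)) :
    x = y := by
  apply Subtype.ext
  apply WithConv.ext
  ext a
  refine coord_induction (L := L) (P := fun a => x.1.ofConv a = y.1.ofConv a) a ?_ ?_ ?_
  · intro c
    rw [Algebra.algebraMap_eq_smul_one, map_smul, map_smul, IsTangent.apply_one x.2,
      IsTangent.apply_one y.2]
  · intro a b ha hb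
    rw [_root_.map_add, _root_.map_add, ha, hb]
  · intro a i ha
    rw [x.2 a, y.2 a, ha, h]

/-- The `i`-th partial derivative. -/
noncomputable def partialDeriv (L : GroupLaw k ι) (i : ι) : Derivation k L.Coord L.Coord :=
  (MvPolynomial.pderiv i : Derivation k (MvPolynomial ι k) (MvPolynomial ι k))

lemma partialDeriv_X [DecidableEq ι] (i j : ι) :
    L.partialDeriv i (L.X j) = if i = j then 1 else 0 := by
  refine (MvPolynomial.pderiv_X (R := k) i j).trans ?_
  rw [Pi.single_apply]
  simp only [eq_comm]
  rfl

variable [Fintype ι]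

/-- The tangent vector `∑ vᵢ ∂ᵢ` at the unit. -/
noncomputable def tangent (L : GroupLaw k ι) (v : ι → k) : lieAlg k L.Coord :=
  ⟨.toConv (∑ i, v i • ((Coalgebra.counit (R := k) (A := L.Coord)) ∘ₗ
    (L.partialDeriv i : L.Coord →ₗ[k] L.Coord))), by
    intro a b
    simp only [LinearMap.sum_apply, LinearMap.smul_apply,
      LinearMap.comp_apply, Derivation.coeFn_coe, Derivation.leibniz, smul_eq_mul, _root_.map_add,
      Bialgebra.counit_mul, Finset.mul_sum, Finset.sum_mul, ← Finset.sum_add_distrib]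
    refine Finset.sum_congr rfl fun i _ => ?_
    ring⟩

@[simp] lemma tangent_X (v : ι → k) (i : ι) : (L.tangent v).1.ofConv (L.X i) = v i := by
  classical
  simp only [tangent, WithConv.ofConv_toConv, LinearMap.sum_apply, LinearMap.smul_apply,
      LinearMap.comp_apply, Derivation.coeFn_coe, partialDeriv_X, smul_eq_mul]
  rw [Finset.sum_eq_single i]
  · simp
  · intro j _ hj
    simp [hj]
  · simp

end GroupLaw

/-! ### The two exact sequences of restricted Lie algebras -/

section Witt

variable (p : ℕ) [Fact p.Prime] (k : Type u) [Field k]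

lemma Ga_comul_X (i : Unit) : Coalgebra.comul (R := k) ((Ga k).X i) =
    (Ga k).X i ⊗ₜ[k] 1 + 1 ⊗ₜ[k] (Ga k).X i := GroupLaw.comul_X i

lemma pMap_Ga [CharP k p] (x : lieAlg k (Ga k).Coord) : pMap p x = 0 := by
  apply GroupLaw.lieAlg_ext
  intro i
  refine IsTangent.pow_char_apply_eq_zero p x.2 (z := 0) ?_
  rw [Ga_comul_X, zero_pow (Fact.out : p.Prime).ne_zero, add_zero]

lemma W2_add {R : Type u} [CommRing R] [Algebra k R] (x y : Fin 2 → R) : (W2 p k).add R x y =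
    ![x 0 + y 0, x 1 + y 1 + wittCocycle p (x 0) (y 0)] := witt_mk_injective p (witt_add p x y)

/-- The first coordinate is additive, and the second is additive up to the `p`-th power of the Witt
cocycle. -/
lemma pMap_W2Frob [CharP k p] (x : lieAlg k (W2Frob p k).Coord) : pMap p x = 0 := by
  apply GroupLaw.lieAlg_ext
  intro i
  fin_cases i
  · refine IsTangent.pow_char_apply_eq_zero p x.2 (z := 0) ?_
    rw [zero_pow (Fact.out : p.Prime).ne_zero, add_zero]
    exact GroupLaw.comul_X _
  · exact IsTangent.pow_char_apply_eq_zero p x.2 (GroupLaw.comul_X _)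

lemma isLieShortExact_W2 [CharP k p] :
    IsLieShortExact p (lieMap (inclW2 p k).comorphism) (lieMap (projW2 p k).comorphism) where
  restricted_left := isRestricted_lieMap p _
  restricted_right := isRestricted_lieMap p _
  injective x y h := by
    apply GroupLaw.lieAlg_ext
    intro i
    have := congrArg (fun z => z.1.ofConv ((W2 p k).X 1)) h
    simpa [lieMap_apply, inclW2] using this
  exact y := by
    constructor
    · intro h
      refine ⟨(Ga k).tangent fun _ => y.1.ofConv ((W2 p k).X 1), GroupLaw.lieAlg_ext fun i => ?_⟩
      have h0 : y.1.ofConv ((W2 p k).X 0) = 0 := by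
        simpa [lieMap_apply, projW2] using congrArg (fun z => z.1.ofConv ((Ga k).X ())) h
      fin_cases i
      · simp [lieMap_apply, inclW2, h0]
      · simp [lieMap_apply, inclW2]
    · rintro ⟨x, rfl⟩
      apply GroupLaw.lieAlg_ext
      intro i
      simp [lieMap_apply, inclW2, projW2]
  surjective x := by
    refine ⟨(W2 p k).tangent ![x.1.ofConv ((Ga k).X ()), 0], GroupLaw.lieAlg_ext fun i => ?_⟩
    simp [lieMap_apply, projW2]

lemma isLieShortExact_W2Frob [CharP k p] :
    IsLieShortExact p (lieMap (inclW2Frob p k).comorphism)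
      (lieMap (projW2Frob p k).comorphism) where
  restricted_left := isRestricted_lieMap p _
  restricted_right := isRestricted_lieMap p _
  injective x y h := by
    apply GroupLaw.lieAlg_ext
    intro i
    have := congrArg (fun z => z.1.ofConv ((W2Frob p k).X 1)) h
    simpa [lieMap_apply, inclW2Frob] using this
  exact y := by
    constructor
    · intro h
      refine ⟨(Ga k).tangent fun _ => y.1.ofConv ((W2Frob p k).X 1),
        GroupLaw.lieAlg_ext fun i => ?_⟩
      have h0 : y.1.ofConv ((W2Frob p k).X 0) = 0 := by
        simpa [lieMap_apply, projW2Frob] using congrArg (fun z => z.1.ofConv ((Ga k).X ())) h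
      fin_cases i
      · simp [lieMap_apply, inclW2Frob, h0]
      · simp [lieMap_apply, inclW2Frob]
    · rintro ⟨x, rfl⟩
      apply GroupLaw.lieAlg_ext
      intro i
      simp [lieMap_apply, inclW2Frob, projW2Frob]
  surjective x := by
    refine ⟨(W2Frob p k).tangent ![x.1.ofConv ((Ga k).X ()), 0], GroupLaw.lieAlg_ext fun i => ?_⟩
    simp [lieMap_apply, projW2Frob]

/-- The `p`-map vanishes on the quotient `Lie(𝔾ₐ)`, so its image lies in the sub `Lie(𝔾ₐ)`, where it
vanishes again. -/
lemma pMap_pMap_W2 [CharP k p] (x : lieAlg k (W2 p k).Coord) : pMap p (pMap p x) = 0 := by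
  have hs := isLieShortExact_W2 p k
  have h0 : lieMap (projW2 p k).comorphism (pMap p x) = 0 := by
    rw [hs.restricted_right, pMap_Ga]
  obtain ⟨y, hy⟩ := (hs.exact _).1 h0
  rw [← hy, ← hs.restricted_left, pMap_Ga, map_zero]

lemma lieMap_frobGa [CharP k p] : lieMap (frobGa p k).comorphism = 0 := by
  refine LieHom.ext fun x => GroupLaw.lieAlg_ext fun i => ?_
  simpa [lieMap_apply, frobGa] using IsTangent.apply_pow_char p x.2 ((Ga k).X i)

lemma inclW2_comp_toW2Frob [CharP k p] :
    (inclW2 p k).comorphism.comp (toW2Frob p k).comorphism =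
      (frobGa p k).comorphism.comp (inclW2Frob p k).comorphism := by
  apply GroupLaw.bialgHom_ext
  intro i
  fin_cases i
  · simp [inclW2, toW2Frob, inclW2Frob]
  · simp [inclW2, toW2Frob, inclW2Frob, frobGa]

lemma toW2Frob_comp_projW2Frob [CharP k p] :
    (toW2Frob p k).comorphism.comp (projW2Frob p k).comorphism = (projW2 p k).comorphism := by
  apply GroupLaw.bialgHom_ext
  intro i
  simp [projW2, toW2Frob, projW2Frob]

/-- The lower sequence of restricted `p`-Lie algebras splits. -/
lemma exists_isRestricted_section [CharP k p] :
    ∃ s : lieAlg k (Ga k).Coord →ₗ⁅k⁆ lieAlg k (W2Frob p k).Coord,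
      IsRestricted p s ∧ (lieMap (projW2Frob p k).comorphism).comp s = LieHom.id := by
  refine ⟨{ toFun x := (W2Frob p k).tangent ![x.1.ofConv ((Ga k).X ()), 0]
            map_add' x y := GroupLaw.lieAlg_ext fun i => ?_
            map_smul' c x := GroupLaw.lieAlg_ext fun i => ?_
            map_lie' {x y} := ?_ }, fun x => ?_, ?_⟩
  · fin_cases i <;> simp
  · fin_cases i <;> simp
  · rw [lie_eq_zero_of_isCocomm, lie_eq_zero_of_isCocomm]
    refine GroupLaw.lieAlg_ext fun i => ?_
    fin_cases i <;> simp
  · rw [pMap_Ga, pMap_W2Frob, map_zero]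
  · refine LieHom.ext fun x => GroupLaw.lieAlg_ext fun i => ?_
    change ((W2Frob p k).tangent _).1.ofConv _ = _
    simp [projW2Frob]

end Witt

end AffGrp

namespace AffGrp

/-! ### The Witt cocycle and multiplication by `p` on Witt vectors -/

section Witt

variable (p : ℕ) [Fact p.Prime]

lemma truncate_teichmuller {R : Type u} [CommRing R] (a : R) :
    WittVector.truncate 2 (WittVector.teichmuller p a) = TruncatedWittVector.mk p ![a, 0] := by
  ext i
  rw [WittVector.coeff_truncate]
  fin_cases i
  · simp
  · simp [WittVector.teichmuller_coeff_pos]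

lemma wittCocycle_eq_coeff {R : Type u} [CommRing R] (a b : R) : wittCocycle p a b =
    (WittVector.teichmuller p a + WittVector.teichmuller p b).coeff 1 := by
  rw [wittCocycle, ← truncate_teichmuller, ← truncate_teichmuller, ← map_add,
    WittVector.coeff_truncate]
  rfl

/-- Compare the ghost components of index `1` of the two sides of a sum of Teichmüller
representatives. -/
lemma natCast_mul_wittCocycle {R : Type u} [CommRing R] (a b : R) :
    (p : R) * wittCocycle p a b = a ^ p + b ^ p - (a + b) ^ p := by
  have h := map_add (WittVector.ghostComponent (p := p) (R := R) 1) (WittVector.teichmuller p a)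
    (WittVector.teichmuller p b)
  have hw (x : WittVector p R) : WittVector.ghostComponent 1 x = x.coeff 0 ^ p + p * x.coeff 1 := by
    rw [WittVector.ghostComponent_apply, wittPolynomial_one]
    simp
    ring
  rw [hw, hw, hw, ← wittCocycle_eq_coeff] at h
  simp only [WittVector.add_coeff_zero, WittVector.teichmuller_coeff_zero,
    WittVector.teichmuller_coeff_pos p _ 1 one_pos, mul_zero, add_zero] at h
  rw [← h]
  ring

/-- The cocycle of `W₂` is `((a ^ p + b ^ p) - (a + b) ^ p) / p`. -/
lemma wittCocycle_eq_sum {R : Type u} [CommRing R] (a b : R) : wittCocycle p a b =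
    ∑ i ∈ Finset.Ioo 0 p, -((p.choose i / p : ℕ) : R) * (a ^ i * b ^ (p - i)) := by
  have hp : p.Prime := Fact.out
  -- Over a domain of characteristic zero one may cancel `p`. The general case is a specialisation
  -- of the universal one over `ℤ[X₀, X₁]`, with `ℤ` lifted to the universe `u`.
  have key : ∀ (S : Type u) [CommRing S] [IsDomain S] [CharZero S] (a b : S), wittCocycle p a b =
      ∑ i ∈ Finset.Ioo 0 p, -((p.choose i / p : ℕ) : S) * (a ^ i * b ^ (p - i)) := by
    intro S _ _ _ a b
    apply mul_left_cancel₀ (Nat.cast_ne_zero.2 hp.ne_zero : (p : S) ≠ 0)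
    have hr : Finset.range (p + 1) = insert 0 (insert p (Finset.Ioo 0 p)) := by
      ext i
      simp only [Finset.mem_range, Finset.mem_insert, Finset.mem_Ioo]
      have := hp.pos
      omega
    rw [natCast_mul_wittCocycle, add_pow, hr, Finset.sum_insert (by simp [hp.ne_zero.symm]),
      Finset.sum_insert (by simp), Finset.mul_sum]
    have e : ∑ i ∈ Finset.Ioo 0 p, (p : S) * (-((p.choose i / p : ℕ) : S) * (a ^ i * b ^ (p - i))) =
        -∑ i ∈ Finset.Ioo 0 p, a ^ i * b ^ (p - i) * (p.choose i : S) := by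
      rw [← Finset.sum_neg_distrib]
      refine Finset.sum_congr rfl fun i hi => ?_
      rw [Finset.mem_Ioo] at hi
      have hd : p ∣ p.choose i := hp.dvd_choose_self hi.1.ne' hi.2
      have hc : (p.choose i : S) = p * ((p.choose i / p : ℕ) : S) := by
        rw [← Nat.cast_mul, Nat.mul_div_cancel' hd]
      rw [hc]
      ring
    rw [e]
    simp
    ring
  have : CharZero (ULift.{u} ℤ) := ⟨fun m n h => by
    simpa using congrArg ULift.down h⟩
  have : IsDomain (ULift.{u} ℤ) := ULift.ringEquiv.toMulEquiv.isDomain ℤ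
  have h := congrArg (MvPolynomial.eval₂Hom ((Int.castRingHom R).comp
    (ULift.ringEquiv : ULift.{u} ℤ ≃+* ℤ).toRingHom) ![a, b])
    (key (MvPolynomial (Fin 2) (ULift.{u} ℤ)) (MvPolynomial.X 0) (MvPolynomial.X 1))
  rw [map_wittCocycle] at h
  simpa using h

/-- In characteristic `p`, multiplication by `p` is `VF`. -/
lemma natCast_nsmul_truncatedWittVector {R : Type u} [CommRing R] [CharP R p] (a : R) :
    p • TruncatedWittVector.mk p ![a, 0] = TruncatedWittVector.mk p ![0, a ^ p] := by
  rw [← truncate_teichmuller, ← map_nsmul, nsmul_eq_mul, mul_comm,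
    ← WittVector.verschiebung_frobenius]
  ext i
  rw [WittVector.coeff_truncate]
  fin_cases i
  · simp
  · exact (WittVector.verschiebung_coeff_succ _ 0).trans (by
      simp [WittVector.coeff_frobenius_charP])

end Witt

/-! ### Multiplication by `n` as a convolution power -/

namespace GroupLaw

variable {k : Type u} [Field k] {ι : Type} (L : GroupLaw k ι)
  {R : Type u} [CommRing R] [Algebra k R]

/-- Multiplication by `n` on points. -/
def nsmul : ℕ → (ι → R) → (ι → R)
  | 0, _ => L.zero R
  | n + 1, x => L.add R (nsmul n x) x

/-- Convolution of algebra morphisms `O(G) → R` is the group law of `G(R)`. This lets multiplication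
by `n` be defined for any Hopf algebra, in particular for a closed subgroup given without
coordinates. -/
lemma toConv_point_mul (x y : ι → R) :
    WithConv.toConv (L.point x).toLinearMap * WithConv.toConv (L.point y).toLinearMap =
      WithConv.toConv (L.point (L.add R x y)).toLinearMap := by
  let m : L.Coord ⊗[k] L.Coord →ₐ[k] R :=
    Algebra.TensorProduct.lift (L.point x) (L.point y) fun _ _ => Commute.all _ _
  have h : m.comp L.comulHom = L.point (L.add R x y) := by
    apply algHom_ext
    rw [comp_comulHom, point_comp_X]
    congr 1 <;> (funext i; simp [m])
  rw [← h]
  apply WithConv.ext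
  refine LinearMap.ext fun a => ?_
  change LinearMap.mul' k R (TensorProduct.map (L.point x).toLinearMap (L.point y).toLinearMap
    (L.comulHom a)) = m (L.comulHom a)
  generalize L.comulHom a = z
  induction z with
  | zero => simp
  | tmul a b => simp [m]
  | add x y hx hy => simp only [_root_.map_add, hx, hy]

lemma toConv_point_pow (x : ι → R) (n : ℕ) : WithConv.toConv (L.point x).toLinearMap ^ n =
      WithConv.toConv (L.point (L.nsmul n x)).toLinearMap := by
  induction n with
  | zero =>
    have h : (Algebra.ofId k R).comp L.counitHom = L.point (L.zero R) := by
      apply algHom_ext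
      rw [comp_counitHom, point_comp_X]
    rw [pow_zero, nsmul, ← h]
    rfl
  | succ n ih => rw [pow_succ, ih, toConv_point_mul, nsmul]

end GroupLaw

lemma algHom_comp_toConv_pow {k A B C : Type u} [Field k] [CommRing A] [HopfAlgebra k A]
    [CommRing B] [Algebra k B] [CommRing C] [Algebra k C] (f : B →ₐ[k] C)
    (φ : WithConv (A →ₗ[k] B)) (n : ℕ) :
    WithConv.toConv (f.toLinearMap ∘ₗ (φ ^ n).ofConv) =
      WithConv.toConv (f.toLinearMap ∘ₗ φ.ofConv) ^ n := by
  induction n with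
  | zero => exact WithConv.ext (by ext; simp)
  | succ n ih =>
    rw [pow_succ, pow_succ, ← ih]
    exact WithConv.ext (LinearMap.algHom_comp_convMul_distrib f (φ ^ n) φ)

lemma toConv_pow_comp_bialgHom {k A B C : Type u} [Field k] [CommRing A] [HopfAlgebra k A]
    [CommRing B] [HopfAlgebra k B] [CommRing C] [Algebra k C] (f : A →ₐc[k] B)
    (φ : WithConv (B →ₗ[k] C)) (n : ℕ) :
    WithConv.toConv ((φ ^ n).ofConv ∘ₗ (f : A →ₗ[k] B)) =
      WithConv.toConv (φ.ofConv ∘ₗ (f : A →ₗ[k] B)) ^ n := by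
  induction n with
  | zero => exact WithConv.ext (by ext; simp)
  | succ n ih =>
    rw [pow_succ, pow_succ, ← ih]
    exact WithConv.ext (LinearMap.convMul_comp_coalgHom_distrib (φ ^ n) φ (f : A →ₗc[k] B))

/-- Morphisms of groups commute with multiplication by `n`. -/
lemma bialgHom_convPow_id {k A B : Type u} [Field k] [CommRing A] [HopfAlgebra k A]
    [CommRing B] [HopfAlgebra k B] (f : A →ₐc[k] B) (n : ℕ) (a : A) :
    f ((WithConv.toConv (LinearMap.id : A →ₗ[k] A) ^ n).ofConv a) =
      (WithConv.toConv (LinearMap.id : B →ₗ[k] B) ^ n).ofConv (f a) := by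
  have h1 := algHom_comp_toConv_pow (f : A →ₐ[k] B) (WithConv.toConv LinearMap.id) n
  have h2 := toConv_pow_comp_bialgHom f (WithConv.toConv LinearMap.id) n
  exact congrArg (fun φ => φ.ofConv a) (h1.trans h2.symm)

namespace GroupLaw

variable {k : Type u} [Field k] {ι : Type} (L : GroupLaw k ι)

/-- The identity of `O(G)` is the universal point, so its `n`-th convolution power is the comorphism
of multiplication by `n`. -/
lemma convPow_id (n : ℕ) : WithConv.toConv (LinearMap.id : L.Coord →ₗ[k] L.Coord) ^ n =
    WithConv.toConv (L.point (L.nsmul n L.X)).toLinearMap := by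
  rw [← toConv_point_pow]
  congr 2
  have : AlgHom.id k L.Coord = L.point L.X := algHom_ext (L.point_comp_X L.X).symm
  rw [← this]
  rfl

end GroupLaw

section Witt

variable (p : ℕ) [Fact p.Prime] (k : Type u) [Field k] {R : Type u} [CommRing R] [Algebra k R]

lemma Ga_nsmul (n : ℕ) (x : Unit → R) : (Ga k).nsmul n x = n • x := by
  induction n with
  | zero => simp [GroupLaw.nsmul, Ga]
  | succ n ih => rw [GroupLaw.nsmul, ih, succ_nsmul]; rfl

lemma W2_nsmul (n : ℕ) (x : Fin 2 → R) :
    TruncatedWittVector.mk p ((W2 p k).nsmul n x) = n • TruncatedWittVector.mk p x := by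
  induction n with
  | zero => rw [zero_nsmul]; rfl
  | succ n ih => rw [succ_nsmul, ← ih]; rfl

lemma W2_nsmul_zero (n : ℕ) (x : Fin 2 → R) : (W2 p k).nsmul n x 0 = n * x 0 := by
  induction n with
  | zero => simp [GroupLaw.nsmul, W2]
  | succ n ih =>
    rw [GroupLaw.nsmul, W2_add]
    simp [ih, add_mul]

variable [CharP k p]

/-- The cocycle of `W₂'` is the Frobenius of that of `W₂`, so the nonlinear part of a multiple is
the `p`-th power of the one in `W₂`. -/
lemma W2Frob_nsmul (n : ℕ) (x : Fin 2 → R) : (W2Frob p k).nsmul n x =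
    ![n * x 0, n * x 1 + (W2 p k).nsmul n ![x 0, 0] 1 ^ p] := by
  induction n with
  | zero =>
    have : (W2 p k).nsmul 0 ![x 0, 0] 1 = 0 := by
      simp [GroupLaw.nsmul, W2]
    rw [this, zero_pow (Fact.out : p.Prime).ne_zero]
    funext i
    fin_cases i <;> simp [GroupLaw.nsmul, W2Frob]
  | succ n ih =>
    rw [GroupLaw.nsmul, ih, GroupLaw.nsmul, W2_add]
    funext i
    fin_cases i
    · simp [W2Frob, add_mul]
    · simp [W2Frob, frob_add p k, W2_nsmul_zero]
      ring

/-- Multiplication by `p` on `W₂'` is `(x₀, x₁) ↦ (0, x₀ ^ p ^ 2)`. -/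
lemma W2Frob_nsmul_char (x : Fin 2 → R) : (W2Frob p k).nsmul p x = ![0, (x 0 ^ p) ^ p] := by
  rcases subsingleton_or_nontrivial R with h | h
  · exact Subsingleton.elim _ _
  · have : CharP R p := charP_of_injective_algebraMap (algebraMap k R).injective p
    have h1 := (W2_nsmul p k p ![x 0, 0]).trans (natCast_nsmul_truncatedWittVector p (x 0))
    rw [W2Frob_nsmul, witt_mk_injective p h1]
    simp

end Witt

end AffGrp

namespace AffGrp

/-! ### Exactness of the group extensions, and descent of bialgebra morphisms -/

section Exact

variable {k : Type u} [Field k]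

/-- The ring `k[x₀, x₁]` is a polynomial ring over `k[x₀]`, hence free. The bijection `e` makes `x₀`
the coefficient variable. -/
lemma mvPolynomial_rename_faithfullyFlat :
    (MvPolynomial.rename (fun _ : Unit => (0 : Fin 2)) :
      MvPolynomial Unit k →ₐ[k] MvPolynomial (Fin 2) k).toRingHom.FaithfullyFlat := by
  let e : Unit ⊕ Unit ≃ Fin 2 :=
    { toFun := Sum.elim (fun _ => 1) (fun _ => 0)
      invFun := ![.inr (), .inl ()]
      left_inv := by rintro (x | x) <;> rfl
      right_inv := by intro i; fin_cases i <;> rfl }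
  let E : MvPolynomial Unit (MvPolynomial Unit k) ≃ₐ[k] MvPolynomial (Fin 2) k :=
    (MvPolynomial.sumAlgEquiv k Unit Unit).symm.trans (MvPolynomial.renameEquiv k e)
  have h : (MvPolynomial.rename (fun _ : Unit => (0 : Fin 2)) :
      MvPolynomial Unit k →ₐ[k] MvPolynomial (Fin 2) k).toRingHom =
      E.toRingEquiv.toRingHom.comp
        (algebraMap (MvPolynomial Unit k) (MvPolynomial Unit (MvPolynomial Unit k))) := by
    have : (MvPolynomial.rename (fun _ : Unit => (0 : Fin 2)) :
      MvPolynomial Unit k →ₐ[k] MvPolynomial (Fin 2) k) = E.toAlgHom.comp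
        (IsScalarTower.toAlgHom k (MvPolynomial Unit k)
          (MvPolynomial Unit (MvPolynomial Unit k))) := by
      apply MvPolynomial.algHom_ext
      intro i
      simp [E, MvPolynomial.algebraMap_eq, e]
    rw [this]
    rfl
  rw [h]
  refine RingHom.FaithfullyFlat.stableUnderComposition _ _ ?_ ?_
  · exact RingHom.faithfullyFlat_algebraMap_iff.2 inferInstance
  · exact RingHom.FaithfullyFlat.of_bijective E.bijective

/-- An extension of `𝔾ₐ` by `𝔾ₐ` with underlying scheme `𝔸²`. -/
lemma isShortExact_of_coordinates {L : GroupLaw k (Fin 2)} {f : L.Coord →ₐc[k] (Ga k).Coord}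
    {g : (Ga k).Coord →ₐc[k] L.Coord} (hf0 : f (L.X 0) = 0) (hf1 : f (L.X 1) = (Ga k).X ())
    (hg : g ((Ga k).X ()) = L.X 0) : IsShortExact f g := by
  let h : (Ga k).Coord →ₐ[k] L.Coord := (Ga k).point fun _ => L.X 1
  refine ⟨?_, ?_, ?_⟩
  · have : (f : L.Coord →ₐ[k] (Ga k).Coord).comp h = AlgHom.id k _ := by
      apply GroupLaw.algHom_ext
      funext i
      simp [h, hf1]
    intro x
    exact ⟨h x, DFunLike.congr_fun this x⟩
  · have : ((g : (Ga k).Coord →ₐ[k] L.Coord)) =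
      (MvPolynomial.rename (fun _ : Unit => (0 : Fin 2)) :
        MvPolynomial Unit k →ₐ[k] MvPolynomial (Fin 2) k) := by
      apply GroupLaw.algHom_ext
      funext i
      refine hg.trans ?_
      exact (MvPolynomial.rename_X (R := k) (fun _ : Unit => (0 : Fin 2)) i).symm
    rw [this]
    exact mvPolynomial_rename_faithfullyFlat
  · apply le_antisymm
    · intro a ha
      set I := (RingHom.ker (Bialgebra.counitAlgHom k (Ga k).Coord)).map
        ((g : (Ga k).Coord →ₐ[k] L.Coord) : (Ga k).Coord →+* L.Coord)
      have h0 : L.X 0 ∈ I := by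
        rw [← hg]
        refine Ideal.mem_map_of_mem _ ?_
        rw [RingHom.mem_ker]
        exact GroupLaw.counit_X (L := Ga k) ()
      -- Modulo `x₀`, the endomorphism `h ∘ f` is the identity, so whatever `f` kills lies in `I`.
      have : (Ideal.Quotient.mkₐ k I).comp (h.comp (f : L.Coord →ₐ[k] (Ga k).Coord)) =
          Ideal.Quotient.mkₐ k I := by
        apply GroupLaw.algHom_ext
        funext i
        fin_cases i
        · simpa [hf0] using (Ideal.Quotient.eq_zero_iff_mem.2 h0).symm
        · simp [hf1, h]
      rw [← Ideal.Quotient.eq_zero_iff_mem]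
      have h2 := DFunLike.congr_fun this a
      have h3 : f a = 0 := ha
      simpa [h3] using h2.symm
    · rw [Ideal.map_le_iff_le_comap]
      intro b hb
      have : (f : L.Coord →ₐ[k] (Ga k).Coord).comp (g : (Ga k).Coord →ₐ[k] L.Coord) =
          (Algebra.ofId k _).comp (Bialgebra.counitAlgHom k (Ga k).Coord) := by
        apply GroupLaw.algHom_ext
        funext i
        have : Coalgebra.counit (R := k) ((Ga k).X i) = 0 := GroupLaw.counit_X i
        simp [hg, hf0, this]
      have h2 := DFunLike.congr_fun this b
      rw [RingHom.mem_ker] at hb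
      rw [AlgHom.comp_apply, AlgHom.comp_apply, hb, map_zero] at h2
      exact h2

/-- An algebra morphism whose composite with an injective bialgebra morphism is a bialgebra
morphism is one. -/
lemma exists_bialgHom_of_comp {A B C : Type u} [CommRing A] [HopfAlgebra k A] [CommRing B]
    [HopfAlgebra k B] [CommRing C] [HopfAlgebra k C] (π : B →ₐc[k] C)
    (hπ : Function.Injective π) (a : A →ₐc[k] C) (c : A →ₐ[k] B)
    (h : (π : B →ₐ[k] C).comp c = a) : ∃ c' : A →ₐc[k] B, (c' : A →ₐ[k] B) = c := by
  refine ⟨BialgHom.ofAlgHom c ?_ ?_, rfl⟩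
  · ext x
    have h1 : π (c x) = a x := DFunLike.congr_fun h x
    have h2 : Coalgebra.counit (R := k) (π (c x)) = Coalgebra.counit (R := k) (c x) := by simp
    rw [h1] at h2
    simpa using h2.symm
  -- Compatibility with comultiplication can be tested after `π ⊗ π`, which is injective because
  -- everything is flat over a field.
  · have hinj : Function.Injective (Algebra.TensorProduct.map (π : B →ₐ[k] C) (π : B →ₐ[k] C)) :=
      TensorProduct.map_injective_of_flat_flat (π : B →ₐ[k] C).toLinearMap
        (π : B →ₐ[k] C).toLinearMap hπ hπ
    have hπc := BialgHom.map_comp_comulAlgHom (R := k) π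
    have hac := BialgHom.map_comp_comulAlgHom (R := k) a
    apply AlgHom.ext
    intro x
    apply hinj
    have e1 := DFunLike.congr_fun hac x
    have e2 := DFunLike.congr_fun hπc (c x)
    have h1 : π (c x) = a x := DFunLike.congr_fun h x
    have e3 : (Algebra.TensorProduct.map (π : B →ₐ[k] C) (π : B →ₐ[k] C)).comp
        (Algebra.TensorProduct.map c c) = Algebra.TensorProduct.map (a : A →ₐ[k] C) a := by
      rw [← Algebra.TensorProduct.map_comp, h]
    rw [← e3] at e1
    refine e1.trans (Eq.trans ?_ e2.symm)
    exact congrArg (Bialgebra.comulAlgHom k C) h1.symm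

end Exact

/-! ### The pushout property of `W₂'` -/

section Pushout

variable (p : ℕ) [Fact p.Prime] (k : Type u) [Field k]

lemma isShortExact_W2 : IsShortExact (inclW2 p k).comorphism (projW2 p k).comorphism := by
  apply isShortExact_of_coordinates <;> simp [inclW2, projW2]

/-- In `W₂` one has `(x₀, x₁) = (x₀, 0) + (0, x₁)`. -/
lemma lift_comp_comulAlgHom_W2 :
    (Algebra.TensorProduct.lift ((W2 p k).point ![(W2 p k).X 0, 0])
      ((W2 p k).point ![0, (W2 p k).X 1]) fun _ _ => Commute.all _ _).comp
          (Bialgebra.comulAlgHom k (W2 p k).Coord) = AlgHom.id k _ := by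
  apply GroupLaw.algHom_ext
  refine ((W2 p k).comp_comulHom _).trans ?_
  rw [W2_add]
  funext i
  fin_cases i
  · simp
  · simp [wittCocycle_comm p ((W2 p k).X 0) 0, wittCocycle_zero]

variable [CharP k p]

lemma isShortExact_W2Frob :
    IsShortExact (inclW2Frob p k).comorphism (projW2Frob p k).comorphism := by
  apply isShortExact_of_coordinates <;> simp [inclW2Frob, projW2Frob]

/-- Raising the other coordinate to the `p`-th power as well turns the map into `MvPolynomial.expand
p`, which is injective. -/
lemma toW2Frob_comorphism_injective : Function.Injective (toW2Frob p k).comorphism := by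
  let e : (W2 p k).Coord →ₐ[k] MvPolynomial (Fin 2) k :=
    (W2 p k).point ![MvPolynomial.X 0 ^ p, MvPolynomial.X 1]
  have h : e.comp ((toW2Frob p k).comorphism : (W2Frob p k).Coord →ₐ[k] (W2 p k).Coord) =
      (MvPolynomial.expand p : MvPolynomial (Fin 2) k →ₐ[k] MvPolynomial (Fin 2) k) := by
    apply GroupLaw.algHom_ext
    funext i
    refine Eq.trans ?_ (MvPolynomial.expand_X p i).symm
    fin_cases i
    · simp [e, toW2Frob]
    · simp [e, toW2Frob]
  have h2 : Function.Injective (e ∘ (toW2Frob p k).comorphism) := by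
    have := MvPolynomial.expand_injective (R := k) (σ := Fin 2) (Fact.out : p.Prime).pos
    rw [← h] at this
    exact this
  exact h2.of_comp

lemma frobGa_comorphism_injective : Function.Injective (frobGa p k).comorphism := by
  have h : ((frobGa p k).comorphism : (Ga k).Coord →ₐ[k] (Ga k).Coord) =
      (MvPolynomial.expand p : MvPolynomial Unit k →ₐ[k] MvPolynomial Unit k) := by
    apply GroupLaw.algHom_ext
    funext i
    refine Eq.trans ?_ (MvPolynomial.expand_X p i).symm
    simp [frobGa]
    rfl
  have := MvPolynomial.expand_injective (R := k) (σ := Unit) (Fact.out : p.Prime).pos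
  rw [← h] at this
  exact this

/-- A morphism out of `W₂` whose restriction to `𝔾ₐ` factors through the Frobenius factors
through `W₂'`. -/
lemma exists_toW2Frob_comp_eq {H : Type u} [CommRing H] [HopfAlgebra k H]
    (a : H →ₐc[k] (W2 p k).Coord) (b : H →ₐc[k] (Ga k).Coord)
    (hab : (inclW2 p k).comorphism.comp a = (frobGa p k).comorphism.comp b) :
    ∃ c : H →ₐ[k] (W2Frob p k).Coord,
      ((toW2Frob p k).comorphism : (W2Frob p k).Coord →ₐ[k] (W2 p k).Coord).comp c = a := by
  let a' : H →ₐ[k] (W2 p k).Coord := a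
  let b' : H →ₐ[k] (Ga k).Coord := b
  let π : (W2Frob p k).Coord →ₐ[k] (W2 p k).Coord := (toW2Frob p k).comorphism
  let x₀ : (W2 p k).Coord →ₐ[k] (W2Frob p k).Coord := (W2 p k).point ![(W2Frob p k).X 0, 0]
  let x₁ : (Ga k).Coord →ₐ[k] (W2Frob p k).Coord := (Ga k).point fun _ => (W2Frob p k).X 1
  let y₀ : (W2 p k).Coord →ₐ[k] (W2 p k).Coord := (W2 p k).point ![(W2 p k).X 0, 0]
  let y₁ : (W2 p k).Coord →ₐ[k] (W2 p k).Coord := (W2 p k).point ![0, (W2 p k).X 1]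
  let z : (Ga k).Coord →ₐ[k] (W2 p k).Coord := (Ga k).point fun _ => (W2 p k).X 1
  have e0 : π.comp x₀ = y₀ := by
    apply GroupLaw.algHom_ext
    funext i
    fin_cases i
    · simp [x₀, y₀, π, toW2Frob]
    · simp [x₀, y₀]
  have z0 : π.comp x₁ =
      z.comp ((frobGa p k).comorphism : (Ga k).Coord →ₐ[k] (Ga k).Coord) := by
    apply GroupLaw.algHom_ext
    funext i
    simp [x₁, z, π, toW2Frob, frobGa]
  have z1 : z.comp ((inclW2 p k).comorphism : (W2 p k).Coord →ₐ[k] (Ga k).Coord) = y₁ := by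
    apply GroupLaw.algHom_ext
    funext i
    fin_cases i
    · simp [y₁, inclW2]
    · simp [z, y₁, inclW2]
  have e1 (h : H) : π (x₁ (b' h)) = y₁ (a' h) := by
    rw [← z1]
    exact (DFunLike.congr_fun z0 (b' h)).trans (congrArg z (DFunLike.congr_fun hab h).symm)
  -- On points this is `(x₀, x₁) ↦ a(x₀, 0) + b(x₁)`. Pulled back to `W₂`, the second term is `b(x₁
  -- ^ p) = a(0, x₁)`, by `hab`, and the sum is `a(x₀, x₁)`.
  refine ⟨(Algebra.TensorProduct.lift (x₀.comp a') (x₁.comp b')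
    fun _ _ => Commute.all _ _).comp (Bialgebra.comulAlgHom k H), ?_⟩
  change π.comp _ = a'
  have e3 : (Algebra.TensorProduct.lift y₀ y₁ fun _ _ => Commute.all _ _).comp
      (Algebra.TensorProduct.map a' a') =
      π.comp (Algebra.TensorProduct.lift (x₀.comp a') (x₁.comp b')
        fun _ _ => Commute.all _ _) := by
    apply Algebra.TensorProduct.ext'
    intro h h'
    have f0 : π (x₀ (a' h)) = y₀ (a' h) := DFunLike.congr_fun e0 (a' h)
    simp only [AlgHom.comp_apply, Algebra.TensorProduct.map_tmul,
      Algebra.TensorProduct.lift_tmul, map_mul, f0, e1]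
  rw [← AlgHom.comp_assoc, ← e3, AlgHom.comp_assoc]
  have e4 : (Algebra.TensorProduct.map a' a').comp (Bialgebra.comulAlgHom k H) =
    (Bialgebra.comulAlgHom k (W2 p k).Coord).comp a' := BialgHom.map_comp_comulAlgHom (R := k) a
  rw [e4, ← AlgHom.comp_assoc, lift_comp_comulAlgHom_W2, AlgHom.id_comp]

/-- `W₂'` is the pushout of `W₂` along the Frobenius of `𝔾ₐ`. -/
lemma isPushout_W2Frob : IsPushout (inclW2 p k).comorphism (frobGa p k).comorphism
      (toW2Frob p k).comorphism (inclW2Frob p k).comorphism where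
  cocomm := inferInstance
  comm := inclW2_comp_toW2Frob p k
  universal H _ _ _ a b hab := by
    have hinj := toW2Frob_comorphism_injective p k
    obtain ⟨c, hc⟩ := exists_toW2Frob_comp_eq p k a b hab
    obtain ⟨c', hc'⟩ := exists_bialgHom_of_comp _ hinj a c hc
    have h1 : (toW2Frob p k).comorphism.comp c' = a := by
      apply BialgHom.coe_toAlgHom_injective
      rw [← hc, ← hc']
      rfl
    refine ⟨c', ⟨h1, ?_⟩, fun c'' h => ?_⟩
    -- The two sides agree after composition with the Frobenius of `𝔾ₐ`, by commutativity of the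
    -- square, and the comorphism of Frobenius is injective.
    · refine BialgHom.ext fun h => ?_
      apply frobGa_comorphism_injective p k
      have e1 := DFunLike.congr_fun hab h
      have e2 := DFunLike.congr_fun (inclW2_comp_toW2Frob p k) (c' h)
      rw [← h1] at e1
      exact e2.symm.trans e1
    · refine BialgHom.ext fun x => ?_
      apply hinj
      exact DFunLike.congr_fun (h.1.trans h1.symm) x

end Pushout

end AffGrp

namespace AffGrp

/-! ### Unipotence from translation-stable spaces of functions -/

section Unipotent

variable {k : Type u} [Field k]

/-- The matrix of a coaction in triangular form on a subspace that generates the coordinate ring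
is a faithful unipotent representation. -/
lemma isUnipotent_of_comul {A : Type u} [CommRing A] [HopfAlgebra k A] {n : ℕ} (v : Fin n → A)
    (M : Matrix (Fin n) (Fin n) A) (f : Fin n → A →ₗ[k] k)
    (hf : ∀ i j, f i (v j) = if i = j then 1 else 0)
    (hM : ∀ j, Coalgebra.comul (R := k) (v j) = ∑ i, v i ⊗ₜ[k] M i j)
    (hdiag : ∀ i, M i i = 1) (hlow : ∀ i j, j < i → M i j = 0)
    (hgen : Algebra.adjoin k (Set.range v) = ⊤) : IsUnipotent k A := by
  refine ⟨n, M, hdiag, hlow, fun i j => ?_, ?_⟩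
  -- Applying the dual form `f i` to the first tensor factor of coassociativity isolates the
  -- comultiplication of `M i j`.
  · have h := congrArg (TensorProduct.lid k (A ⊗[k] A) ∘ LinearMap.rTensor (A ⊗[k] A) (f i))
      (Coalgebra.coassoc_apply (R := k) (v j))
    rw [hM j] at h
    simp only [map_sum, LinearMap.rTensor_tmul, LinearMap.lTensor_tmul, hM,
      TensorProduct.sum_tmul, TensorProduct.assoc_tmul, Function.comp_apply,
      TensorProduct.lid_tmul, hf, ite_smul, one_smul, zero_smul, Finset.sum_ite_eq,
      Finset.mem_univ, if_true] at h
    exact h.symm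
  · rw [eq_top_iff, ← hgen]
    refine Algebra.adjoin_le ?_
    rintro _ ⟨j, rfl⟩
    -- The counit axiom writes `v j` as a linear combination of the entries of column `j`, so the
    -- entries generate as well.
    have h := congrArg (TensorProduct.lid k A) (Coalgebra.rTensor_counit_comul (R := k) (v j))
    rw [hM j] at h
    simp only [map_sum, LinearMap.rTensor_tmul, TensorProduct.lid_tmul, one_smul] at h
    rw [← h]
    exact Subalgebra.sum_mem _ fun i _ => Subalgebra.smul_mem _
      (Algebra.subset_adjoin (Set.mem_range_self (i, j))) _

namespace GroupLaw

variable {ι : Type} {L : GroupLaw k ι}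

lemma adjoin_X (L : GroupLaw k ι) : Algebra.adjoin k (Set.range L.X) = ⊤ :=
  MvPolynomial.adjoin_range_X (σ := ι) (R := k)

lemma smooth_coord [Finite ι] : Algebra.Smooth k L.Coord :=
  have : Algebra.Smooth k (MvPolynomial ι k) := ⟨inferInstance, inferInstance⟩
  this

instance : IsDomain L.Coord := inferInstanceAs (IsDomain (MvPolynomial ι k))

lemma exists_dual_monomial [DecidableEq (ι →₀ ℕ)] (e : ι →₀ ℕ) : ∃ f : L.Coord →ₗ[k] k,
    ∀ e', f (MvPolynomial.monomial (R := k) e' 1 : MvPolynomial ι k) = if e' = e then 1 else 0 := by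
  refine ⟨(MvPolynomial.basisMonomials ι k).coord e, fun e' => ?_⟩
  have h := (MvPolynomial.basisMonomials ι k).repr_self e'
  rw [MvPolynomial.coe_basisMonomials] at h
  refine (congrArg (fun g => g e) h).trans ?_
  rw [Finsupp.single_apply]

end GroupLaw

lemma isUnipotent_Ga : IsUnipotent k (Ga k).Coord := by
  refine ⟨2, !![1, (Ga k).X (); 0, 1], ?_, ?_, ?_, ?_⟩
  · intro i; fin_cases i <;> rfl
  · intro i j h
    fin_cases i <;> fin_cases j <;> first | rfl | exact absurd h (by decide)
  · intro i j
    fin_cases i <;> fin_cases j <;>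
      simp [Fin.sum_univ_two, Ga_comul_X, Algebra.TensorProduct.one_def, add_comm]
  · rw [eq_top_iff, ← (Ga k).adjoin_X]
    refine Algebra.adjoin_mono ?_
    rintro _ ⟨i, rfl⟩
    exact ⟨(0, 1), rfl⟩

/-- An extension of `𝔾ₐ` by `𝔾ₐ` with a cocycle homogeneous of degree `N` is unipotent: the
span of `1, x₀, …, x₀ ^ (N - 1), x₁` is stable under translations. -/
lemma isUnipotent_of_cocycle {L : GroupLaw k (Fin 2)} (N : ℕ) (hN : 2 ≤ N) (d : ℕ → k)
    (h0 : Coalgebra.comul (R := k) (L.X 0) = L.X 0 ⊗ₜ[k] 1 + 1 ⊗ₜ[k] L.X 0)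
    (h1 : Coalgebra.comul (R := k) (L.X 1) = L.X 1 ⊗ₜ[k] 1 + 1 ⊗ₜ[k] L.X 1 +
      ∑ i ∈ Finset.Ioo 0 N, d i • ((L.X 0 ^ i) ⊗ₜ[k] (L.X 0 ^ (N - i)))) :
    IsUnipotent k L.Coord := by
  classical
  let v : Fin (N + 1) → L.Coord := fun j => if (j : ℕ) < N then L.X 0 ^ (j : ℕ) else L.X 1
  -- Column `j` lists the coefficients of the translate of `v j`: binomial ones for `x₀ ^ j`, and
  -- those of the cocycle for `x₁`. Putting `x₁` last makes the matrix upper triangular.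
  let M : Matrix (Fin (N + 1)) (Fin (N + 1)) L.Coord := fun i j =>
    if (j : ℕ) < N then ((j : ℕ).choose i : L.Coord) * L.X 0 ^ ((j : ℕ) - i) else
      if (i : ℕ) = 0 then L.X 1 else if (i : ℕ) < N then d i • L.X 0 ^ (N - i) else 1
  -- The functions `v j` are distinct monomials, so coefficient forms serve as dual forms.
  let e : Fin (N + 1) → (Fin 2 →₀ ℕ) := fun j =>
    if (j : ℕ) < N then Finsupp.single 0 (j : ℕ) else Finsupp.single 1 1
  have hv (j) : v j = (MvPolynomial.monomial (R := k) (e j) 1 : MvPolynomial (Fin 2) k) := by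
    dsimp only [v, e]
    split_ifs
    · exact MvPolynomial.X_pow_eq_monomial
    · rfl
  have he : Function.Injective e := by
    intro i j h
    dsimp only [e] at h
    have hi := i.2
    have hj := j.2
    split_ifs at h with a b b
    · exact Fin.ext (Finsupp.single_injective _ h)
    · have := DFunLike.congr_fun h 1
      simp at this
    · have := DFunLike.congr_fun h 1
      simp at this
    · exact Fin.ext (by omega)
  choose f hf using fun i => GroupLaw.exists_dual_monomial (L := L) (e i)
  have hle : N ≠ 0 := by omega
  refine isUnipotent_of_comul v M f (fun i j => ?_) (fun j => ?_) (fun i => ?_) (fun i j h => ?_) ?_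
  · rw [hv, hf]
    simp [he.eq_iff, eq_comm]
  · rw [Fin.sum_univ_castSucc]
    by_cases hj : (j : ℕ) < N
    · have hpow : Coalgebra.comul (R := k) (L.X 0 ^ (j : ℕ)) = ∑ i ∈ Finset.range N,
          (L.X 0 ^ i) ⊗ₜ[k] (((j : ℕ).choose i : L.Coord) * L.X 0 ^ ((j : ℕ) - i)) := by
        rw [Bialgebra.comul_pow, h0, add_pow]
        refine Eq.trans (Finset.sum_congr rfl fun i _ => ?_)
          (Finset.sum_subset (Finset.range_subset_range.2 hj) fun i _ hi => ?_)
        · rw [Algebra.TensorProduct.tmul_pow, Algebra.TensorProduct.tmul_pow,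
            Algebra.TensorProduct.tmul_mul_tmul, one_pow, one_pow, mul_one, one_mul, mul_comm,
            ← nsmul_eq_mul, ← nsmul_eq_mul, TensorProduct.tmul_smul]
        · rw [Nat.choose_eq_zero_of_lt (by simpa using hi)]
          simp
      have hlast : v (Fin.last N) ⊗ₜ[k] M (Fin.last N) j = 0 := by
        simp [M, hj, Nat.choose_eq_zero_of_lt hj]
      rw [hlast, add_zero]
      simp only [v, hj, if_true, hpow, M, Fin.val_castSucc, Fin.is_lt]
      exact (Fin.sum_univ_eq_sum_range (fun i => (L.X 0 ^ i) ⊗ₜ[k]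
        (((j : ℕ).choose i : L.Coord) * L.X 0 ^ ((j : ℕ) - i))) N).symm
    · simp only [v, M, hj, if_false, Fin.val_castSucc, Fin.is_lt, if_true, Fin.val_last,
        lt_irrefl, hle, h1]
      have hr : Finset.range N = insert 0 (Finset.Ioo 0 N) := by
        ext i
        simp only [Finset.mem_range, Finset.mem_insert, Finset.mem_Ioo]
        omega
      rw [Fin.sum_univ_eq_sum_range (fun i => (L.X 0 ^ i) ⊗ₜ[k]
        (if i = 0 then L.X 1 else d i • L.X 0 ^ (N - i))) N, hr, Finset.sum_insert (by simp)]
      have hs : ∑ i ∈ Finset.Ioo 0 N, (L.X 0 ^ i) ⊗ₜ[k]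
          (if i = 0 then L.X 1 else d i • L.X 0 ^ (N - i)) =
          ∑ i ∈ Finset.Ioo 0 N, d i • ((L.X 0 ^ i) ⊗ₜ[k] (L.X 0 ^ (N - i))) := by
        refine Finset.sum_congr rfl fun i hi => ?_
        rw [if_neg (by rw [Finset.mem_Ioo] at hi; omega), TensorProduct.tmul_smul]
      rw [hs]
      simp only [pow_zero, if_true]
      abel
  · dsimp only [M]
    split_ifs
    · simp
    · omega
    · rfl
  · have hi := i.2
    have hj : (j : ℕ) < i := h
    dsimp only [M]
    rw [if_pos (by omega), Nat.choose_eq_zero_of_lt hj, Nat.cast_zero, zero_mul]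
  · rw [eq_top_iff, ← L.adjoin_X]
    refine Algebra.adjoin_mono ?_
    rintro _ ⟨i, rfl⟩
    fin_cases i
    · exact ⟨⟨1, by omega⟩, by simp [v, show 1 < N by omega]⟩
    · exact ⟨Fin.last N, by simp [v]⟩

end Unipotent

section Witt

variable (p : ℕ) [Fact p.Prime] (k : Type u) [Field k]

lemma wittCocycle_tmul {A : Type u} [CommRing A] [Algebra k A] (a b : A) :
    wittCocycle p (a ⊗ₜ[k] (1 : A)) ((1 : A) ⊗ₜ[k] b) =
      ∑ i ∈ Finset.Ioo 0 p, (-((p.choose i / p : ℕ) : k)) • ((a ^ i) ⊗ₜ[k] (b ^ (p - i))) := by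
  rw [wittCocycle_eq_sum]
  refine Finset.sum_congr rfl fun i _ => ?_
  rw [Algebra.TensorProduct.tmul_pow, Algebra.TensorProduct.tmul_pow,
    Algebra.TensorProduct.tmul_mul_tmul, one_pow, one_pow, mul_one, one_mul, neg_smul, neg_mul,
    Nat.cast_smul_eq_nsmul, nsmul_eq_mul]

lemma isUnipotent_W2 : IsUnipotent k (W2 p k).Coord := by
  refine isUnipotent_of_cocycle p (Fact.out : p.Prime).two_le
    (fun i => -((p.choose i / p : ℕ) : k)) ?_ ?_
  · rw [GroupLaw.comul_X, W2_add]
    rfl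
  · rw [GroupLaw.comul_X, W2_add, wittCocycle_tmul]
    rfl

/-- The Frobenius of the Witt cocycle is homogeneous of degree `p ^ 2`, with only exponents
divisible by `p`. The sum is reindexed by `i ↦ p * i`. -/
lemma isUnipotent_W2Frob [CharP k p] : IsUnipotent k (W2Frob p k).Coord := by
  have hp := (Fact.out : p.Prime).two_le
  refine isUnipotent_of_cocycle (p * p) (by nlinarith)
    (fun i => if p ∣ i then (-((p.choose (i / p) / p : ℕ) : k)) ^ p else 0)
    (GroupLaw.comul_X _) ?_
  rw [GroupLaw.comul_X]
  refine congrArg (((W2Frob p k).X 1 ⊗ₜ[k] 1 + 1 ⊗ₜ[k] (W2Frob p k).X 1) + ·) ?_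
  have hsum (s : Finset ℕ) (g : ℕ → (W2Frob p k).Coord ⊗[k] (W2Frob p k).Coord) :
      (∑ i ∈ s, g i) ^ p = ∑ i ∈ s, g i ^ p := by
    induction s using Finset.induction_on with
    | empty => simp [(Fact.out : p.Prime).ne_zero]
    | insert a s ha ih => rw [Finset.sum_insert ha, Finset.sum_insert ha, frob_add p k, ih]
  dsimp only
  rw [wittCocycle_tmul, hsum]
  simp only [ite_smul, zero_smul]
  rw [← Finset.sum_filter]
  refine Finset.sum_bij (fun i _ => p * i) ?_ ?_ ?_ ?_
  · intro i hi
    rw [Finset.mem_Ioo] at hi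
    simp only [Finset.mem_filter, Finset.mem_Ioo, dvd_mul_right, and_true]
    constructor <;> nlinarith
  · intro i _ j _ h
    exact Nat.eq_of_mul_eq_mul_left (by omega) h
  · intro j hj
    simp only [Finset.mem_filter, Finset.mem_Ioo] at hj
    obtain ⟨⟨h0, h1⟩, i, rfl⟩ := hj
    refine ⟨i, ?_, rfl⟩
    rw [Finset.mem_Ioo]
    exact ⟨Nat.pos_of_mul_pos_left h0, Nat.lt_of_mul_lt_mul_left h1⟩
  · intro i _
    rw [Nat.mul_div_cancel_left _ (by omega : 0 < p), ← Nat.mul_sub]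
    rw [smul_pow, Algebra.TensorProduct.tmul_pow, ← pow_mul, ← pow_mul, mul_comm i, mul_comm _ p]

lemma isIntegrable_top {A : Type u} [CommRing A] [HopfAlgebra k A]
    (h : IsSmoothConnectedUnipotent k A) :
    IsIntegrable (⊤ : LieSubalgebra k (lieAlg k A)) := by
  refine ⟨A, inferInstance, inferInstance, BialgHom.id k A, Function.surjective_id, h, ?_⟩
  rw [eq_top_iff]
  intro x _
  exact ⟨x, rfl⟩

lemma isSmoothConnectedUnipotent_coord {ι : Type} [Finite ι] {L : GroupLaw k ι}
    (h : IsUnipotent k L.Coord) : IsSmoothConnectedUnipotent k L.Coord :=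
  ⟨GroupLaw.smooth_coord, inferInstance, h⟩

end Witt

end AffGrp

namespace AffGrp

/-! ### Smoothness and transcendental functions -/

section Smooth

open Polynomial in
/-- On a smooth group, a function with nonzero differential at the unit is transcendental: a
tangent vector lifts to jets of any order. -/
lemma transcendental_of_tangent {k V : Type u} [Field k] [CommRing V] [HopfAlgebra k V]
    [Algebra.FormallySmooth k V] (δ : lieAlg k V) {t : V} (h0 : Coalgebra.counit (R := k) t = 0)
    (ht : δ.1.ofConv t ≠ 0) : Transcendental k t := by
  rw [transcendental_iff]
  intro g hg
  by_contra hne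
  obtain ⟨q, hq, hqX⟩ := exists_eq_pow_rootMultiplicity_mul_and_not_dvd g hne 0
  set m := g.rootMultiplicity 0
  rw [C_0, sub_zero] at hq hqX
  set J : Ideal k[X] := Ideal.span {X ^ (m + 2)}
  let mk : k[X] →ₐ[k] k[X] ⧸ J := Ideal.Quotient.mkₐ k J
  have hmk (f : k[X]) : mk f = 0 ↔ X ^ (m + 2) ∣ f := by
    rw [← Ideal.mem_span_singleton]
    exact Ideal.Quotient.eq_zero_iff_mem
  let I : Ideal (k[X] ⧸ J) := Ideal.span {mk X ^ 2}
  have hI : IsNilpotent I := by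
    refine ⟨m + 2, ?_⟩
    rw [Ideal.span_singleton_pow, Ideal.zero_eq_bot, Ideal.span_singleton_eq_bot, ← map_pow,
      ← map_pow, hmk, ← pow_mul]
    exact pow_dvd_pow _ (by omega)
  let θ' : V →ₗ[k] k[X] := LinearMap.toSpanSingleton k k[X] 1 ∘ₗ Coalgebra.counit +
    LinearMap.toSpanSingleton k k[X] X ∘ₗ δ.1.ofConv
  have hθ' (v : V) : θ' v = C (Coalgebra.counit (R := k) v) + C (δ.1.ofConv v) * X := by
    simp [θ', smul_eq_C_mul]
  -- The map `v ↦ ε(v) + δ(v) X` is multiplicative modulo `X ^ 2` because `δ` is a tangent vector.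
  -- Formal smoothness lifts it along the nilpotent ideal `I`.
  let θ : V →ₐ[k] (k[X] ⧸ J) ⧸ I := AlgHom.ofLinearMap
    ((Ideal.Quotient.mkₐ k I).toLinearMap ∘ₗ mk.toLinearMap ∘ₗ θ')
    (by
      have : θ' 1 = 1 := by rw [hθ', IsTangent.apply_one δ.2]; simp
      simp [this])
    (by
      intro v w
      have e : θ' (v * w) = θ' v * θ' w - X ^ 2 * C (δ.1.ofConv v * δ.1.ofConv w) := by
        rw [hθ', hθ', hθ', δ.2 v w]
        simp only [Bialgebra.counit_mul, C_mul, C_add]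
        ring
      have hmem : mk (θ' (v * w)) - mk (θ' v) * mk (θ' w) ∈ I := by
        rw [← map_mul mk, ← map_sub mk, e, sub_sub_cancel_left, map_neg, map_mul, map_pow]
        exact I.neg_mem (Ideal.mul_mem_right _ _ (Ideal.mem_span_singleton_self _))
      exact (Ideal.Quotient.eq.2 hmem).trans (map_mul (Ideal.Quotient.mk I) _ _))
  let φ : V →ₐ[k] k[X] ⧸ J := Algebra.FormallySmooth.lift I hI θ
  have hφ : ∃ G : k[X], φ t = mk (X * (C (δ.1.ofConv t) + X * G)) := by
    have h1 : Ideal.Quotient.mk I (φ t) = Ideal.Quotient.mk I (mk (θ' t)) :=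
      Algebra.FormallySmooth.mk_lift I hI θ t
    rw [Ideal.Quotient.eq, Ideal.mem_span_singleton] at h1
    obtain ⟨b, hb⟩ := h1
    obtain ⟨G, rfl⟩ := Ideal.Quotient.mk_surjective b
    refine ⟨G, ?_⟩
    rw [hθ', h0, sub_eq_iff_eq_add] at hb
    rw [hb]
    change mk X ^ 2 * mk G + _ = _
    rw [← map_pow, ← map_mul, ← map_add]
    congr 1
    rw [C_0]
    ring
  obtain ⟨G, hG⟩ := hφ
  have h1 : mk (g.comp (X * (C (δ.1.ofConv t) + X * G))) = 0 := by
    rw [comp_eq_aeval, ← aeval_algHom_apply, ← hG, aeval_algHom_apply, hg, map_zero]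
  -- After cancelling `X ^ m`, the constant term of what remains is `δ(t) ^ m * q(0)`. It is
  -- divisible by `X`, hence zero, a contradiction.
  rw [hmk, hq, mul_comp, pow_comp, X_comp, mul_pow, pow_add, mul_assoc] at h1
  have h2 := (mul_dvd_mul_iff_left (pow_ne_zero m X_ne_zero)).1 h1
  have h3 := (dvd_pow_self X two_ne_zero).trans h2
  rw [X_dvd_iff, coeff_zero_eq_eval_zero] at h3
  simp only [eval_mul, eval_pow, eval_add, eval_C, eval_X, eval_comp, zero_mul, add_zero] at h3
  rw [mul_eq_zero, ← coeff_zero_eq_eval_zero, ← X_dvd_iff] at h3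
  exact h3.elim (pow_ne_zero _ ht) hqX

lemma point_injective_of_transcendental {k V : Type u} [Field k] [CommRing V] [Algebra k V]
    {t : V} (ht : Transcendental k t) : Function.Injective ((Ga k).point fun _ => t) := by
  rw [injective_iff_map_eq_zero]
  intro b hb
  let E : MvPolynomial Unit k ≃ₐ[k] Polynomial k := MvPolynomial.uniqueAlgEquiv k Unit
  have h : (Polynomial.aeval t).comp E.toAlgHom = (Ga k).point fun _ => t := by
    apply GroupLaw.algHom_ext (L := Ga k)
    funext i
    have : E ((Ga k).X i) = Polynomial.X := by
      simp [E, GroupLaw.X]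
    change Polynomial.aeval t (E ((Ga k).X i)) = _
    rw [this]
    simp
  have h1 : Polynomial.aeval t (E b) = 0 := (DFunLike.congr_fun h b).trans hb
  have h2 := transcendental_iff.1 ht _ h1
  exact (map_eq_zero_iff E E.injective).1 h2

end Smooth

/-! ### Lie algebras of closed subgroups -/

section Lift

variable {k : Type u} [Field k] {A B V : Type u} [CommRing A] [HopfAlgebra k A] [CommRing B]
  [HopfAlgebra k B] [CommRing V] [HopfAlgebra k V]

/-- The Lie algebra of a closed subgroup contains that of every subgroup contained in it. -/
lemma range_lieMap_le_of_ker_le (q : A →ₐc[k] V) (hq : Function.Surjective q) (i : A →ₐc[k] B)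
    (h : ∀ a, q a = 0 → i a = 0) : (lieMap i).range ≤ (lieMap q).range := by
  rintro _ ⟨x, rfl⟩
  obtain ⟨σ, hσ⟩ := (q : A →ₗ[k] V).exists_rightInverse_of_surjective
    (LinearMap.range_eq_top.2 hq)
  have hqσ (v : V) : q (σ v) = v := DFunLike.congr_fun hσ v
  have hi {a b : A} (hab : q a = q b) : i a = i b := by
    rw [← sub_eq_zero, ← map_sub]
    exact h _ (by rw [map_sub, hab, sub_self])
  -- Since `i` kills the kernel of `q`, it factors through `V`. The factorisation is expressed with
  -- a linear section `σ` of `q`, and only its multiplicativity and its compatibility with the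
  -- counit are needed.
  refine ⟨⟨.toConv (x.1.ofConv ∘ₗ (i : A →ₗ[k] B) ∘ₗ σ), fun v w => ?_⟩, ?_⟩
  · have e1 : i (σ (v * w)) = i (σ v) * i (σ w) := by
      rw [← map_mul]
      exact hi (by rw [hqσ, map_mul, hqσ, hqσ])
    have e2 (v : V) : Coalgebra.counit (R := k) (i (σ v)) = Coalgebra.counit (R := k) v := by
      rw [← congrArg (Coalgebra.counit (R := k)) (hqσ v)]
      simp
    have e3 := x.2 (i (σ v)) (i (σ w))
    rw [← e1, e2, e2] at e3
    exact e3
  · apply Subtype.ext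
    apply WithConv.ext
    ext a
    exact congrArg x.1.ofConv (hi (hqσ (q a)))

end Lift

/-! ### Non-integrability of the sections and of their images -/

section Witt

variable (p : ℕ) [Fact p.Prime] (k : Type u) [Field k] [CharP k p]

/-- Multiplication by `p` on `W₂'` factors as `i' ∘ Frob ^ 2 ∘ r'`. -/
lemma convPow_id_W2Frob (a : (W2Frob p k).Coord) :
    (WithConv.toConv (LinearMap.id : (W2Frob p k).Coord →ₗ[k] (W2Frob p k).Coord) ^ p).ofConv a =
      (Ga k).point (fun _ => ((W2Frob p k).X 0 ^ p) ^ p) ((inclW2Frob p k).comorphism a) := by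
  rw [GroupLaw.convPow_id, W2Frob_nsmul_char]
  have : ((Ga k).point (fun _ => ((W2Frob p k).X 0 ^ p) ^ p)).comp
      ((inclW2Frob p k).comorphism : (W2Frob p k).Coord →ₐ[k] (Ga k).Coord) =
      (W2Frob p k).point ![0, ((W2Frob p k).X 0 ^ p) ^ p] := by
    apply GroupLaw.algHom_ext
    funext i
    fin_cases i <;> simp [inclW2Frob]
  rw [← this]
  rfl

variable {p k}

lemma section_apply_X {s : lieAlg k (Ga k).Coord →ₗ⁅k⁆ lieAlg k (W2Frob p k).Coord}
    (hs : (lieMap (projW2Frob p k).comorphism).comp s = LieHom.id) (x : lieAlg k (Ga k).Coord) :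
    (s x).1.ofConv ((W2Frob p k).X 0) = x.1.ofConv ((Ga k).X ()) := by
  have := congrArg (fun y => y.1.ofConv ((Ga k).X ())) (DFunLike.congr_fun hs x)
  simpa [lieMap_apply, projW2Frob] using this

/-- Multiplication by `p` kills `𝔾ₐ` and is `(x₀, x₁) ↦ (0, x₀ ^ p ^ 2)` on `W₂'`, so every
morphism `𝔾ₐ → W₂'` lands in the kernel of the projection. -/
lemma bialgHom_W2Frob_Ga_X (σ : (W2Frob p k).Coord →ₐc[k] (Ga k).Coord) :
    σ ((W2Frob p k).X 0) = 0 := by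
  -- The coordinate `x₁` is the one on which multiplication by `p` is nonzero. The relation becomes
  -- `σ(x₀) ^ p ^ 2 = 0` in a domain.
  have h := bialgHom_convPow_id σ p ((W2Frob p k).X 1)
  rw [convPow_id_W2Frob, GroupLaw.convPow_id, Ga_nsmul] at h
  have hp : p • (Ga k).X = 0 := by
    funext i
    have : CharP (Ga k).Coord p :=
      charP_of_injective_algebraMap (algebraMap k (Ga k).Coord).injective p
    simp
  have hε : (Ga k).point (0 : Unit → (Ga k).Coord) = (Algebra.ofId k _).comp
      (Bialgebra.counitAlgHom k (Ga k).Coord) := by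
    apply GroupLaw.algHom_ext
    funext i
    have : Coalgebra.counit (R := k) ((Ga k).X i) = 0 := GroupLaw.counit_X i
    simp [this]
  have h1 : Coalgebra.counit (R := k) ((W2Frob p k).X 1) = 0 := GroupLaw.counit_X 1
  rw [hp, hε] at h
  have hp0 := (Fact.out : p.Prime).ne_zero
  simpa [inclW2Frob, h1, hp0] using h

lemma not_isIntegrableHom_section
    {s : lieAlg k (Ga k).Coord →ₗ⁅k⁆ lieAlg k (W2Frob p k).Coord}
    (hs : (lieMap (projW2Frob p k).comorphism).comp s = LieHom.id) : ¬ IsIntegrableHom s := by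
  rintro ⟨σ, rfl⟩
  have h := section_apply_X hs ((Ga k).tangent 1)
  rw [lieMap_apply, bialgHom_W2Frob_Ga_X] at h
  simp at h

/-- A smooth closed subgroup of `W₂'` whose tangent space surjects onto that of `𝔾ₐ` contains
the kernel of `W₂' → 𝔾ₐ`. -/
lemma range_lieMap_inclW2Frob_le {V : Type u} [CommRing V] [HopfAlgebra k V]
    [Algebra.FormallySmooth k V] (q : (W2Frob p k).Coord →ₐc[k] V) (hq : Function.Surjective q)
    (δ : lieAlg k V) (hδ : δ.1.ofConv (q ((W2Frob p k).X 0)) ≠ 0) :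
    (lieMap (inclW2Frob p k).comorphism).range ≤ (lieMap q).range := by
  refine range_lieMap_le_of_ker_le q hq _ fun a ha => ?_
  have h0 : Coalgebra.counit (R := k) (q ((W2Frob p k).X 0)) = 0 := by
    have : Coalgebra.counit (R := k) ((W2Frob p k).X 0) = 0 := GroupLaw.counit_X 0
    simpa using this
  have hp := (Fact.out : p.Prime).pos
  have ht := ((transcendental_of_tangent δ h0 hδ).pow hp).pow hp
  -- If `q a = 0`, then pulling back `a` along multiplication by `p` on `V` gives zero. This
  -- pullback is the polynomial `i'(a)` evaluated at the transcendental `t ^ p ^ 2`, so `i'(a) = 0`.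
  apply point_injective_of_transcendental ht
  rw [map_zero]
  have h := bialgHom_convPow_id q p a
  rw [ha, map_zero, convPow_id_W2Frob] at h
  have e : (q : (W2Frob p k).Coord →ₐ[k] V).comp
      ((Ga k).point (fun _ => ((W2Frob p k).X 0 ^ p) ^ p)) =
      (Ga k).point fun _ => (q ((W2Frob p k).X 0) ^ p) ^ p := by
    apply GroupLaw.algHom_ext
    funext i
    simp
  rw [← e]
  exact h

lemma not_isIntegrable_range_section
    {s : lieAlg k (Ga k).Coord →ₗ⁅k⁆ lieAlg k (W2Frob p k).Coord}
    (hs : (lieMap (projW2Frob p k).comorphism).comp s = LieHom.id) : ¬ IsIntegrable s.range := by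
  rintro ⟨V, _, _, q, hq, hV, hr⟩
  have := hV.smooth
  obtain ⟨δ, hδ⟩ : s ((Ga k).tangent 1) ∈ (lieMap q).range := hr ▸ ⟨_, rfl⟩
  have h1 : δ.1.ofConv (q ((W2Frob p k).X 0)) = 1 := by
    have := section_apply_X hs ((Ga k).tangent 1)
    rw [← hδ] at this
    simpa [lieMap_apply] using this
  have hle := range_lieMap_inclW2Frob_le q hq δ (by simp [h1])
  rw [hr] at hle
  -- The nonzero vector of `Lie(𝔾ₐ)` would lie in the image of `s`. Its first coordinate is zero,
  -- which forces `y = 0`, while its second coordinate is `1`.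
  obtain ⟨y, hy⟩ := hle ⟨(Ga k).tangent 1, rfl⟩
  have hy' : s y = lieMap (inclW2Frob p k).comorphism ((Ga k).tangent 1) := hy
  have hy0 : y = 0 := by
    apply GroupLaw.lieAlg_ext
    intro i
    have := section_apply_X hs y
    rw [hy'] at this
    simpa [lieMap_apply, inclW2Frob] using this.symm
  rw [hy0, map_zero] at hy'
  have := congrArg (fun z => z.1.ofConv ((W2Frob p k).X 1)) hy'
  simp [lieMap_apply, inclW2Frob] at this

end Witt

end AffGrp

open AffGrp in
theorem mainTheorem8 (p : ℕ) [Fact p.Prime] (k : Type u) [Field k] [CharP k p] [PerfectField k] :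
    -- the commutative diagram of algebraic groups: exact rows, left square a pushout
    IsShortExact (inclW2 p k).comorphism (projW2 p k).comorphism ∧
    IsShortExact (inclW2Frob p k).comorphism (projW2Frob p k).comorphism ∧
    IsPushout (inclW2 p k).comorphism (frobGa p k).comorphism
      (toW2Frob p k).comorphism (inclW2Frob p k).comorphism ∧
    (toW2Frob p k).comorphism.comp (projW2Frob p k).comorphism = (projW2 p k).comorphism ∧
    -- the derived commutative diagram of restricted `p`-Lie algebras, with exact rows
    IsLieShortExact p (lieMap (inclW2 p k).comorphism) (lieMap (projW2 p k).comorphism) ∧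
    IsLieShortExact p (lieMap (inclW2Frob p k).comorphism) (lieMap (projW2Frob p k).comorphism) ∧
    IsRestricted p (lieMap (toW2Frob p k).comorphism) ∧
    lieMap (frobGa p k).comorphism = 0 ∧
    (lieMap (toW2Frob p k).comorphism).comp (lieMap (inclW2 p k).comorphism) =
      (lieMap (inclW2Frob p k).comorphism).comp (lieMap (frobGa p k).comorphism) ∧
    (lieMap (projW2Frob p k).comorphism).comp (lieMap (toW2Frob p k).comorphism) =
      lieMap (projW2 p k).comorphism ∧
    -- the three groups are smooth, connected and unipotent; their Lie algebras are `p`-nil and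
    -- integrable
    (IsSmoothConnectedUnipotent k (Ga k).Coord ∧
      IsPNil p (⊤ : LieSubalgebra k (lieAlg k (Ga k).Coord)) ∧
      IsIntegrable (⊤ : LieSubalgebra k (lieAlg k (Ga k).Coord))) ∧
    (IsSmoothConnectedUnipotent k (W2 p k).Coord ∧
      IsPNil p (⊤ : LieSubalgebra k (lieAlg k (W2 p k).Coord)) ∧
      IsIntegrable (⊤ : LieSubalgebra k (lieAlg k (W2 p k).Coord))) ∧
    (IsSmoothConnectedUnipotent k (W2Frob p k).Coord ∧
      IsPNil p (⊤ : LieSubalgebra k (lieAlg k (W2Frob p k).Coord)) ∧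
      IsIntegrable (⊤ : LieSubalgebra k (lieAlg k (W2Frob p k).Coord))) ∧
    -- the lower sequence of restricted `p`-Lie algebras splits
    (∃ s : lieAlg k (Ga k).Coord →ₗ⁅k⁆ lieAlg k (W2Frob p k).Coord,
      IsRestricted p s ∧ (lieMap (projW2Frob p k).comorphism).comp s = LieHom.id) ∧
    -- no such splitting integrates, and neither does its image, a `p`-nil `p`-subalgebra
    (∀ s : lieAlg k (Ga k).Coord →ₗ⁅k⁆ lieAlg k (W2Frob p k).Coord,
      IsRestricted p s → (lieMap (projW2Frob p k).comorphism).comp s = LieHom.id →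
        ¬ IsIntegrableHom s ∧
        IsPSubalgebra p s.range ∧ IsPNil p s.range ∧ ¬ IsIntegrable s.range) := by
  have hGa : IsSmoothConnectedUnipotent k (Ga k).Coord :=
    isSmoothConnectedUnipotent_coord k isUnipotent_Ga
  have hW : IsSmoothConnectedUnipotent k (W2 p k).Coord :=
    isSmoothConnectedUnipotent_coord k (isUnipotent_W2 p k)
  have hF : IsSmoothConnectedUnipotent k (W2Frob p k).Coord :=
    isSmoothConnectedUnipotent_coord k (isUnipotent_W2Frob p k)
  refine ⟨isShortExact_W2 p k, isShortExact_W2Frob p k, isPushout_W2Frob p k,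
    toW2Frob_comp_projW2Frob p k, isLieShortExact_W2 p k, isLieShortExact_W2Frob p k,
    isRestricted_lieMap p _, lieMap_frobGa p k, ?_, ?_,
    ⟨hGa, fun x _ => ⟨1, pMap_Ga p k x⟩, isIntegrable_top k hGa⟩,
    ⟨hW, fun x _ => ⟨2, pMap_pMap_W2 p k x⟩, isIntegrable_top k hW⟩,
    ⟨hF, fun x _ => ⟨1, pMap_W2Frob p k x⟩, isIntegrable_top k hF⟩,
    exists_isRestricted_section p k, fun s _ hs => ⟨not_isIntegrableHom_section hs,
      fun x _ => ?_, fun x _ => ⟨1, pMap_W2Frob p k x⟩, not_isIntegrable_range_section hs⟩⟩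
  · rw [lieMap_comp, lieMap_comp, inclW2_comp_toW2Frob]
  · rw [lieMap_comp, toW2Frob_comp_projW2Frob]
  · rw [pMap_W2Frob]
    exact zero_mem _
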